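/- **Setting.** Let $\mathcal M_i=(S_i,\hat s_i,A_i,T_i,L_i)$, $i=1,\dots,N$, be finite MDPs (for each state $s$ and action $a$, $T_i(s,a,\cdot)$ is a probability distribution, or identically zero if $a$ is not available in $s$). In $\mathcal M=\mathcal M_1\|\dots\|\mathcal M_N$ an action is performed jointly by all components whose alphabet contains it, the others do not move, and the label of a state is the union of the local labels. Each $A_i$ is partitioned into active, passive and normal actions $A_{i,a},A_{i,p},A_{i,n}$, and the system is well communicated: every $a\in A_{i,a}$ lies in $A_{j,p}$ for some $j\ne i$, and every $a\in A_{i,p}$ lies in $A_{j,a}$ for exactly one $j\neq i$. Let $\varphi=\mathcal P_{\le p}[\psi_1\,\mathcal U^{\le k}\,\psi_2]$, $p\in[0,1]$, $k\in\mathbb N$, where $\psi_1,\psi_2$ are strict-liveness PCTL formulas, $\psi::=\mathit{true}\mid a\mid\psi\vee\psi\mid\psi\wedge\psi\mid\neg\mathcal P_{\le q}[X\psi]\mid\neg\mathcal P_{\le q}[\psi\,\mathcal U^{\le m}\psi]$. Satisfaction of $\mathcal P_{\le q}$ quantifies over all (history-dependent, deterministic) schedulers; a path ends in a state without available actions. Assume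 that if $p<1$ then the initial state of $\mathcal M$ does not satisfy $\psi_2$ in $\mathcal M$. A local supervisor $\mathcal K_i$ is a finite automaton over $S_i\times A_i$ with a deterministic partial transition function $\delta_i$; $\mathcal M_i\|_{\sup}\mathcal K_i$ has states $(s,q)$ and the transitions $(s,q)\xrightarrow{a}(s',q')$ with probability $T_i(s,a,s')$ where $\delta_i(q,(s,a))=q'$. Let a model checker be given that is sound and complete for $\varphi$ on compositions of $N$ MDPs: on every input it reports that $\varphi$ holds if and only if the composition satisfies $\varphi$, and otherwise it returns a real counterexample, i.e. a finite path of at most $k$ steps from the initial state that minimally witnesses $\psi_1\,\mathcal U^{\le k}\psi_2$ and has positive probability under some scheduler violating the bound $p$. **Algorithm N-SPVSYN.** Initially every $\mathcal K_i$ allows everything, the L* observation table of subsystem $i$ has prefix and suffix sets $\{\varepsilon\}$, and its set $C_i$ of negative counterexamples is empty. In each iteration, the composition of the $\mathcal M_i\|_{\sup}\mathcal K_i$ is model checked. If a counterexample path is returned, one subsystem $j$ is selected: one that actively performs the last action of the path that is active for some subsystem, or, if the very last action is active for no subsystem, possibly one for which this last action is normal. The projection of the path to the local states and actions of $j$ (a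 word over $S_j\times A_j$) is passed to $j$ as a negative counterexample and added to $C_j$. Every other subsystem $i$ (every subsystem, if the model checker reports that $\varphi$ holds) gets a positive counterexample if there is one, i.e. a state-action word of a path of $\mathcal M_i$ of length at most $k$ which is not a word of $\mathcal M_i\|_{\sup}\mathcal K_i$ and has no element of $C_i$ as a prefix. Every subsystem with a counterexample adds it and all its prefixes to the prefix set of its table, makes the table closed and consistent by the repair steps of L*, and replaces $\mathcal K_i$ by the conjectured DFA without its transitions to non-accepting states; a membership query for $w$ is answered with 1 if and only if $|w|>k$, or $w$ is a state-action word of a path of $\mathcal M_i$ from $\hat s_i$ and no element of $C_i$ is a prefix of $w$. The other supervisors are unchanged. If no subsystem gets a counterexample, the algorithm returns $\mathcal K_1,\dots,\mathcal K_N$. **Theorem.** Whatever choices are made (counterexamples, selection, order of the L* repair steps), every run of the algorithm terminates: it consists of finitely many iterations, each with finitely many L* steps; it never gets stuck before it returns. The returned supervisors satisfy $$(\mathcal M_1\|_{\sup}\mathcal K_1)\,\|\dots\|\,(\mathcal M_N\|_{\sup}\mathcal K_N)\models\varphi .$$ -/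

import Mathlib

namespace SupSyn

/-! ### Markov decision processes -/

/-- A finite Markov decision process with actions named in `Act` and atomic propositions in `AP`.
For every state `s` and action `a` the numbers `T s a s'` are either the transition probabilities
of `a` (they sum to `1`, and `a` is available in `s`) or all zero (`a` is not available). -/
structure MDP (Act AP : Type) where
  State : Type
  [fintypeState : Fintype State]
  init : State
  alphabet : Finset Act
  T : State → Act → State → ℝ
  label : State → Set AP
  T_nonneg : ∀ s a s', 0 ≤ T s a s'
  T_outside : ∀ s a s', a ∉ alphabet → T s a s' = 0
  T_sum : ∀ s a, (∑ s', T s a s') = 0 ∨ (∑ s', T s a s') = 1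

attribute [instance] MDP.fintypeState

namespace MDP

variable {Act AP : Type}

/-- `a` is an available action in the state `s`. -/
def Enabled (M : MDP Act AP) (s : M.State) (a : Act) : Prop := ∃ s', 0 < M.T s a s'

/-- A nonempty finite sequence: a first state followed by steps (action, next state). -/
structure History (M : MDP Act AP) where
  start : M.State
  steps : List (Act × M.State)

/-- The last state of a finite sequence. -/
def History.last {M : MDP Act AP} (h : M.History) : M.State :=
  (h.steps.map Prod.snd).getLastD h.start

/-- Extend a finite sequence by one step. -/
def History.snoc {M : MDP Act AP} (h : M.History) (a : Act) (s : M.State) : M.History :=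
  ⟨h.start, h.steps ++ [(a, s)]⟩

/-- `s, r` is a path: every transition has positive probability. -/
def IsPath (M : MDP Act AP) : M.State → List (Act × M.State) → Prop
  | _, [] => True
  | s, (a, s') :: r => 0 < M.T s a s' ∧ M.IsPath s' r

/-- A scheduler chooses an available action after every finite history. It stops (`none`) only in
a state where no action is available. -/
structure Scheduler (M : MDP Act AP) where
  choose : M.History → Option Act
  choose_enabled : ∀ h a, choose h = some a → M.Enabled h.last a
  choose_total : ∀ h, choose h = none → ∀ a, ¬ M.Enabled h.last a

open Classical in
/-- The probability, under the scheduler `σ`, that the history `h` is continued by the given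
steps (the probability of a cylinder set of the induced Markov chain). -/
noncomputable def Scheduler.prob {M : MDP Act AP} (σ : M.Scheduler) :
    M.History → List (Act × M.State) → ℝ
  | _, [] => 1
  | h, (a, s') :: r =>
      (if σ.choose h = some a then M.T h.last a s' else 0) * σ.prob (h.snoc a s') r

/-- The finite path `s, r` is a minimal witness of `A U B`: its last state is in `B`, all
earlier states are in `A` and not in `B`. -/
def UntilWitness (M : MDP Act AP) (A B : M.State → Prop) :
    M.State → List (Act × M.State) → Prop
  | s, [] => B s
  | s, (_, s') :: r => A s ∧ ¬ B s ∧ M.UntilWitness A B s' r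

open Classical in
/-- The probability of `A U^{≤ k} B` from the state `s` under `σ`: the event is the disjoint union
of the cylinder sets of its minimal witnesses, which have at most `k` steps. -/
noncomputable def Scheduler.untilProb {M : MDP Act AP} (σ : M.Scheduler) (A B : M.State → Prop)
    (k : ℕ) (s : M.State) : ℝ :=
  ∑ n ∈ Finset.range (k + 1), ∑ r : Fin n → M.alphabet × M.State,
    let steps := List.ofFn fun t => ((r t).1.1, (r t).2)
    if M.UntilWitness A B s steps then σ.prob ⟨s, []⟩ steps else 0

open Classical in
/-- The probability of `X B` from the state `s` under `σ`. -/
noncomputable def Scheduler.nextProb {M : MDP Act AP} (σ : M.Scheduler) (B : M.State → Prop)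
    (s : M.State) : ℝ :=
  ∑ a ∈ M.alphabet, ∑ s' : M.State, if B s' then σ.prob ⟨s, []⟩ [(a, s')] else 0

end MDP

/-! ### Time-bounded weak-safety PCTL -/

/-- The strict liveness fragment `ψ`. -/
inductive LiveFormula (AP : Type) where
  | tt : LiveFormula AP
  | atom : AP → LiveFormula AP
  | or : LiveFormula AP → LiveFormula AP → LiveFormula AP
  | and : LiveFormula AP → LiveFormula AP → LiveFormula AP
  | notNext : unitInterval → LiveFormula AP → LiveFormula AP
  | notUntil : unitInterval → ℕ → LiveFormula AP → LiveFormula AP → LiveFormula AP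

/-- The weak safety fragment `φ`. -/
inductive SafeFormula (AP : Type) where
  | tt : SafeFormula AP
  | atom : AP → SafeFormula AP
  | or : SafeFormula AP → SafeFormula AP → SafeFormula AP
  | and : SafeFormula AP → SafeFormula AP → SafeFormula AP
  | next : unitInterval → LiveFormula AP → SafeFormula AP
  | until : unitInterval → ℕ → LiveFormula AP → LiveFormula AP → SafeFormula AP

/-- `P_{≤ p}[...]` quantifies over all schedulers; its negation is `notNext`, `notUntil`. -/
def LiveFormula.Sat {Act AP : Type} (M : MDP Act AP) : LiveFormula AP → M.State → Prop
  | .tt, _ => True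
  | .atom a, s => a ∈ M.label s
  | .or f g, s => f.Sat M s ∨ g.Sat M s
  | .and f g, s => f.Sat M s ∧ g.Sat M s
  | .notNext p f, s => ¬ ∀ σ : M.Scheduler, σ.nextProb (fun t => f.Sat M t) s ≤ (p : ℝ)
  | .notUntil p k f g, s =>
      ¬ ∀ σ : M.Scheduler, σ.untilProb (fun t => f.Sat M t) (fun t => g.Sat M t) k s ≤ (p : ℝ)

def SafeFormula.Sat {Act AP : Type} (M : MDP Act AP) : SafeFormula AP → M.State → Prop
  | .tt, _ => True
  | .atom a, s => a ∈ M.label s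
  | .or f g, s => f.Sat M s ∨ g.Sat M s
  | .and f g, s => f.Sat M s ∧ g.Sat M s
  | .next p f, s => ∀ σ : M.Scheduler, σ.nextProb (f.Sat M) s ≤ (p : ℝ)
  | .until p k f g, s => ∀ σ : M.Scheduler, σ.untilProb (f.Sat M) (g.Sat M) k s ≤ (p : ℝ)

/-- `M ⊨ φ`. -/
def MDP.Models {Act AP : Type} (M : MDP Act AP) (φ : SafeFormula AP) : Prop := φ.Sat M M.init

/-! ### Parallel composition and supervision -/

namespace MDP

variable {Act AP : Type}

open Classical in
/-- The parallel composition `M_1 || ... || M_N`: an action is performed jointly by all components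
that have it in their alphabet, while the other components do not move. -/
noncomputable def parallel {N : ℕ} (M : Fin N → MDP Act AP) : MDP Act AP where
  State := ∀ i, (M i).State
  init := fun i => (M i).init
  alphabet := Finset.univ.biUnion fun i => (M i).alphabet
  T := fun s a s' =>
    if ∃ i, a ∈ (M i).alphabet then
      ∏ i, (if a ∈ (M i).alphabet then (M i).T (s i) a (s' i) else if s' i = s i then 1 else 0)
    else 0
  label := fun s => ⋃ i, (M i).label (s i)
  T_nonneg := by
    intro s a s'
    split_ifs
    · refine Finset.prod_nonneg fun i _ => ?_
      split_ifs
      · exact (M i).T_nonneg _ _ _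
      · exact zero_le_one
      · exact le_rfl
    · exact le_rfl
  T_outside := by
    intro s a s' h
    rw [if_neg]
    simpa using h
  T_sum := by
    intro s a
    split_ifs
    · have key : (∑ s' : ∀ i, (M i).State, ∏ i, (if a ∈ (M i).alphabet then
          (M i).T (s i) a (s' i) else if s' i = s i then (1 : ℝ) else 0)) =
          ∏ i, ∑ t : (M i).State, (if a ∈ (M i).alphabet then
            (M i).T (s i) a t else if t = s i then (1 : ℝ) else 0) := by
        rw [Finset.prod_univ_sum, Fintype.piFinset_univ]
      have fac : ∀ i, (∑ t : (M i).State, (if a ∈ (M i).alphabet then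
            (M i).T (s i) a t else if t = s i then (1 : ℝ) else 0)) = 0 ∨
          (∑ t : (M i).State, (if a ∈ (M i).alphabet then
            (M i).T (s i) a t else if t = s i then (1 : ℝ) else 0)) = 1 := by
        intro i
        by_cases h : a ∈ (M i).alphabet
        · simpa [h] using (M i).T_sum (s i) a
        · right
          simp [h]
      rw [key]
      by_cases h : ∃ i, (∑ t : (M i).State, (if a ∈ (M i).alphabet then
            (M i).T (s i) a t else if t = s i then (1 : ℝ) else 0)) = 0
      · obtain ⟨i, hi⟩ := h
        exact Or.inl (Finset.prod_eq_zero (Finset.mem_univ i) hi)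
      · push Not at h
        exact Or.inr (Finset.prod_eq_one fun i _ => (fac i).resolve_left (h i))
    · left
      simp

/-- The alphabet `S × A` of the supervisors of `M`. -/
abbrev Letter (M : MDP Act AP) : Type := M.State × M.alphabet

end MDP

/-- A deterministic finite automaton over the alphabet `Sym`, with a partial transition function. -/
structure Automaton (Sym : Type) where
  Q : Type
  [fintypeQ : Fintype Q]
  δ : Q → Sym → Option Q
  start : Q
  accept : Set Q

attribute [instance] Automaton.fintypeQ

/-- The one-state automaton that accepts every word. -/
def Automaton.all (Sym : Type) : Automaton Sym where
  Q := Unit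
  δ := fun _ _ => some ()
  start := ()
  accept := Set.univ

open Classical in
/-- Eliminate all transitions to non-accepting states. -/
noncomputable def Automaton.trim {Sym : Type} (K : Automaton Sym) : Automaton Sym where
  Q := K.Q
  δ := fun q x => (K.δ q x).filter (fun q' => decide (q' ∈ K.accept))
  start := K.start
  accept := K.accept

namespace MDP

variable {Act AP : Type}

open Classical in
/-- The controlled system `M ||_sup K`: the transitions of `M` that are also defined in `K`. -/
noncomputable def sup (M : MDP Act AP) (K : Automaton M.Letter) : MDP Act AP where
  State := M.State × K.Q
  init := (M.init, K.start)
  alphabet := M.alphabet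
  T := fun s a s' =>
    if h : a ∈ M.alphabet then
      if K.δ s.2 (s.1, ⟨a, h⟩) = some s'.2 then M.T s.1 a s'.1 else 0
    else 0
  label := fun s => M.label s.1
  T_nonneg := by
    intro s a s'
    split_ifs
    · exact M.T_nonneg _ _ _
    · exact le_rfl
    · exact le_rfl
  T_outside := by
    intro s a s' h
    rw [dif_neg h]
  T_sum := by
    intro s a
    by_cases h : a ∈ M.alphabet
    · simp only [h, dite_true]
      rw [Fintype.sum_prod_type]
      cases hq : K.δ s.2 (s.1, ⟨a, h⟩) with
      | none => left; simp
      | some q => simpa using M.T_sum s.1 a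
    · left
      simp [h]

/-- The word over `S × A` (states and the actions taken in them) of a path. -/
noncomputable def word (M : MDP Act AP) : M.State → List (Act × M.State) → List M.Letter
  | _, [] => []
  | s, (a, s') :: r =>
      open Classical in
      if h : a ∈ M.alphabet then (s, ⟨a, h⟩) :: M.word s' r else M.word s' r

/-- The state-action words of the paths of `M` from its initial state, that is, the language of
the finite automaton underlying `M` (all states accepting). -/
def words (M : MDP Act AP) : Set (List M.Letter) :=
  {w | ∃ r, M.IsPath M.init r ∧ M.word M.init r = w}

/-- The words of `M` that are still possible in `M ||_sup K` (the supervisor's states dropped). -/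
def controlledWords (M : MDP Act AP) (K : Automaton M.Letter) : Set (List M.Letter) :=
  {w | ∃ v ∈ (M.sup K).words,
    v.map (fun x : (M.State × K.Q) × M.alphabet => (x.1.1, x.2)) = w}

end MDP

/-! ### The L* learner -/

/-- The answers to membership queries, given the time bound `k` and the negative counterexamples
`C` received so far: words longer than `k` are accepted; other words are accepted if they belong to
the automaton underlying `M` and no element of `C` is a prefix of them. -/
def target {Act AP : Type} (M : MDP Act AP) (k : ℕ) (C : Finset (List M.Letter)) :
    Set (List M.Letter) :=
  {w | k < w.length ∨ (w ∈ M.words ∧ ∀ c ∈ C, ¬ c <+: w)}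

/-- The prefixes `S` and the suffixes `E` of an observation table. Its entries are the answers to
the membership queries `s ++ e`. -/
structure Table (Sym : Type) where
  S : Finset (List Sym)
  E : Finset (List Sym)
  nil_mem : [] ∈ S

namespace Table

variable {Sym : Type}

/-- The initial observation table, `S = E = {ε}`. -/
def initial (Sym : Type) : Table Sym := ⟨{[]}, {[]}, by simp⟩

open Classical in
/-- The row of the word `s`, as the set of the suffixes `e` at which its entry is `1`. -/
noncomputable def row (t : Table Sym) (L : Set (List Sym)) (s : List Sym) : Finset (List Sym) :=
  t.E.filter fun e => s ++ e ∈ L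

def Closed (t : Table Sym) (L : Set (List Sym)) : Prop :=
  ∀ s ∈ t.S, ∀ x : Sym, ∃ s' ∈ t.S, t.row L s' = t.row L (s ++ [x])

def Consistent (t : Table Sym) (L : Set (List Sym)) : Prop :=
  ∀ s₁ ∈ t.S, ∀ s₂ ∈ t.S, t.row L s₁ = t.row L s₂ →
    ∀ x : Sym, t.row L (s₁ ++ [x]) = t.row L (s₂ ++ [x])

open Classical in
noncomputable def addPrefix (t : Table Sym) (s : List Sym) : Table Sym :=
  ⟨insert s t.S, t.E, Finset.mem_insert_of_mem t.nil_mem⟩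

open Classical in
noncomputable def addSuffix (t : Table Sym) (e : List Sym) : Table Sym := ⟨t.S, insert e t.E, t.nil_mem⟩

open Classical in
/-- A counterexample to a conjecture is added to `S` together with all its prefixes. -/
noncomputable def addCounterexample (t : Table Sym) (w : List Sym) : Table Sym :=
  ⟨t.S ∪ w.inits.toFinset, t.E, Finset.mem_union_left _ t.nil_mem⟩

/-- One repair of a table that is not closed or not consistent. -/
inductive Repair (L : Set (List Sym)) (t : Table Sym) : Table Sym → Prop
  | close (s : List Sym) (x : Sym) (hs : s ∈ t.S)
      (h : ∀ s' ∈ t.S, t.row L s' ≠ t.row L (s ++ [x])) : Repair L t (t.addPrefix (s ++ [x]))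
  | makeConsistent (s₁ s₂ : List Sym) (x : Sym) (e : List Sym) (h₁ : s₁ ∈ t.S) (h₂ : s₂ ∈ t.S)
      (hrow : t.row L s₁ = t.row L s₂) (he : e ∈ t.E)
      (hne : ¬ (s₁ ++ [x] ++ e ∈ L ↔ s₂ ++ [x] ++ e ∈ L)) : Repair L t (t.addSuffix (x :: e))

open Classical in
/-- The automaton conjectured from a closed and consistent table: the states are the rows of the
elements `s` of `S`, the transitions lead from the row of `s` to the row of `s ++ [x]`, and the row
of `s` is accepting if the answer for `s` is `1`. -/
noncomputable def conjecture (t : Table Sym) (L : Set (List Sym)) : Automaton Sym where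
  Q := {q // q ∈ t.S.image (t.row L)}
  δ := fun q x =>
    let s := (Finset.mem_image.mp q.2).choose
    if h : t.row L (s ++ [x]) ∈ t.S.image (t.row L) then some ⟨_, h⟩ else none
  start := ⟨t.row L [], Finset.mem_image_of_mem _ t.nil_mem⟩
  accept := {q | ∃ s ∈ t.S, t.row L s = q.1 ∧ s ∈ L}

end Table

/-! ### Well-communicated systems and subsystem selection -/

/-- A partition of every local alphabet into active, passive and normal actions. -/
structure ActionPartition {Act AP : Type} {N : ℕ} (M : Fin N → MDP Act AP) where
  active : Fin N → Set Act
  passive : Fin N → Set Act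
  normal : Fin N → Set Act
  union_eq : ∀ i, active i ∪ passive i ∪ normal i = ((M i).alphabet : Set Act)
  active_passive : ∀ i, Disjoint (active i) (passive i)
  active_normal : ∀ i, Disjoint (active i) (normal i)
  passive_normal : ∀ i, Disjoint (passive i) (normal i)

namespace ActionPartition

variable {Act AP : Type} {N : ℕ} {M : Fin N → MDP Act AP}

def WellCommunicated (P : ActionPartition M) : Prop :=
  (∀ i, ∀ a ∈ P.active i, ∃ j, j ≠ i ∧ a ∈ P.passive j) ∧
  (∀ i, ∀ a ∈ P.passive i, ∃! j, j ≠ i ∧ a ∈ P.active j)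

/-- Subsystem `i` may be selected as the cause of the action sequence `as`: it actively performs
the last action that is active for some subsystem, or the very last action is active for no
subsystem and is a normal action of `i`. -/
def Selects (P : ActionPartition M) (as : List Act) (i : Fin N) : Prop :=
  (∃ u a v, as = u ++ a :: v ∧ a ∈ P.active i ∧ ∀ b ∈ v, ∀ j, b ∉ P.active j) ∨
  (∃ u a, as = u ++ [a] ∧ a ∈ P.normal i ∧ ∀ j, a ∉ P.active j)

end ActionPartition

/-! ### Model checking -/

section Checking

variable {Act AP : Type} {N : ℕ}

/-- A counterexample path (its steps from the initial state) to `M ⊨ P_{≤ p}[ψ₁ U^{≤ k} ψ₂]`: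
a minimal witness of `ψ₁ U^{≤ k} ψ₂` that has positive probability under some scheduler which
violates the bound `p`. -/
def IsCounterexample (M : MDP Act AP) (p : unitInterval) (k : ℕ) (ψ₁ ψ₂ : LiveFormula AP)
    (r : List (Act × M.State)) : Prop :=
  ∃ σ : M.Scheduler, (p : ℝ) < σ.untilProb (ψ₁.Sat M) (ψ₂.Sat M) k M.init ∧
    r.length ≤ k ∧ M.UntilWitness (ψ₁.Sat M) (ψ₂.Sat M) M.init r ∧ 0 < σ.prob ⟨M.init, []⟩ r

/-- A compositional model checker for a fixed specification: it gets the components, and answers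
either `none` (the composition satisfies the specification) or a path of the composition. -/
abbrev ModelChecker (Act AP : Type) (N : ℕ) : Type 1 :=
  (C : Fin N → MDP Act AP) → Option (List (Act × (MDP.parallel C).State))

/-- The model checker is sound and complete for the specification: a positive answer is given if
and only if the composition satisfies it, and otherwise a real counterexample is returned. -/
def ModelChecker.SoundComplete (mc : ModelChecker Act AP N) (p : unitInterval) (k : ℕ)
    (ψ₁ ψ₂ : LiveFormula AP) : Prop :=
  ∀ C : Fin N → MDP Act AP,
    (mc C = none ↔ (MDP.parallel C).Models (.until p k ψ₁ ψ₂)) ∧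
    ∀ r, mc C = some r → IsCounterexample (MDP.parallel C) p k ψ₁ ψ₂ r

end Checking

/-! ### The synthesis algorithm -/

section Algorithm

variable {Act AP : Type} {N : ℕ}

/-- What is stored for one subsystem: the observation table, the negative counterexamples received
so far, the current local supervisor, and whether a call of the L* learner is in progress. -/
structure Learner (M : MDP Act AP) where
  table : Table M.Letter
  negatives : Finset (List M.Letter)
  K : Automaton M.Letter
  learning : Prop

/-- The counterexample (if any) that a subsystem gets in an iteration. -/
inductive Feedback (Sym : Type) where
  | none : Feedback Sym
  | positive : List Sym → Feedback Sym
  | negative : List Sym → Feedback Sym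

/-- `w` is a positive counterexample: a path of `M` of length at most `k` that is absent from the
supervised system and has no negative counterexample as a prefix. -/
def Learner.IsPositive {M : MDP Act AP} (l : Learner M) (k : ℕ) (w : List M.Letter) : Prop :=
  w.length ≤ k ∧ w ∈ M.words ∧ w ∉ M.controlledWords l.K ∧ ∀ c ∈ l.negatives, ¬ c <+: w

/-- Feedback for a subsystem that has not been selected: a positive counterexample if there is
one. -/
def Learner.PositiveFeedback {M : MDP Act AP} (l : Learner M) (k : ℕ) :
    Feedback M.Letter → Prop
  | .none => ∀ w, ¬ l.IsPositive k w
  | .positive w => l.IsPositive k w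
  | .negative _ => False

open Classical in
/-- Start a call of the L* learner with the given counterexample. -/
noncomputable def Learner.receive {M : MDP Act AP} (l : Learner M) :
    Feedback M.Letter → Learner M
  | .none => l
  | .positive w => ⟨l.table.addCounterexample w, l.negatives, l.K, True⟩
  | .negative w => ⟨l.table.addCounterexample w, insert w l.negatives, l.K, True⟩

/-- A step of a call of the L* learner: repair the table, or, if it is closed and consistent,
return the supervisor obtained from the conjectured automaton. -/
inductive Learner.Step {M : MDP Act AP} (k : ℕ) (l : Learner M) : Learner M → Prop
  | repair (h : l.learning) (t : Table M.Letter)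
      (ht : Table.Repair (target M k l.negatives) l.table t) :
      Learner.Step k l ⟨t, l.negatives, l.K, True⟩
  | conjecture (h : l.learning) (hcl : l.table.Closed (target M k l.negatives))
      (hco : l.table.Consistent (target M k l.negatives)) :
      Learner.Step k l
        ⟨l.table, l.negatives, (l.table.conjecture (target M k l.negatives)).trim, False⟩

/-- A state of the algorithm. -/
structure Config (M : Fin N → MDP Act AP) where
  learner : ∀ i, Learner (M i)
  returned : Prop

/-- The start of the algorithm: every local supervisor allows everything. -/
def Config.initial (M : Fin N → MDP Act AP) : Config M where
  learner := fun _ => ⟨Table.initial _, ∅, Automaton.all _, False⟩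
  returned := False

/-- The components `M_i ||_sup K_i`. -/
noncomputable def Config.components {M : Fin N → MDP Act AP} (c : Config M) (i : Fin N) :
    MDP Act AP :=
  (M i).sup (c.learner i).K

open Classical in
/-- The projection of a path of the controlled composition to the subsystem `i`: the local states
and the local actions taken in them. -/
noncomputable def project {M : Fin N → MDP Act AP} (K : ∀ i, Automaton (M i).Letter) (i : Fin N) :
    (∀ j, (M j).State × (K j).Q) → List (Act × (∀ j, (M j).State × (K j).Q)) →
      List (M i).Letter
  | _, [] => []
  | s, (a, s') :: r =>
      if h : a ∈ (M i).alphabet then ((s i).1, ⟨a, h⟩) :: project K i s' r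
      else project K i s' r

/-- `fb` is a possible result of the checking part of an iteration in the state `c`. If the model
checker returns a counterexample path, a selected subsystem gets its projection as a negative
counterexample. All other subsystems get positive counterexamples, where these exist. -/
def Config.FeedbackFor {M : Fin N → MDP Act AP} (P : ActionPartition M)
    (mc : ModelChecker Act AP N) (k : ℕ) (c : Config M)
    (fb : ∀ i, Feedback (M i).Letter) : Prop :=
  (mc c.components = none ∧ ∀ i, (c.learner i).PositiveFeedback k (fb i)) ∨
  (∃ r, mc c.components = some r ∧ ∃ j, P.Selects (r.map Prod.fst) j ∧
    fb j = .negative (project (fun i => (c.learner i).K) j (MDP.parallel c.components).init r) ∧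
    ∀ i, i ≠ j → (c.learner i).PositiveFeedback k (fb i))

/-- The steps of the synthesis algorithm: a step of a running L* learner, the checking part of an
iteration with at least one counterexample, or the return of the current supervisors if there is
no counterexample. -/
inductive Config.Step {M : Fin N → MDP Act AP} (P : ActionPartition M)
    (mc : ModelChecker Act AP N) (k : ℕ) (c : Config M) : Config M → Prop
  | learn (hret : ¬ c.returned) (i : Fin N) (l : Learner (M i))
      (h : Learner.Step k (c.learner i) l) :
      Config.Step P mc k c ⟨Function.update c.learner i l, False⟩
  | refine (hret : ¬ c.returned) (hidle : ∀ i, ¬ (c.learner i).learning)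
      (fb : ∀ i, Feedback (M i).Letter) (hfb : c.FeedbackFor P mc k fb)
      (hex : ∃ i, fb i ≠ .none) :
      Config.Step P mc k c ⟨fun i => (c.learner i).receive (fb i), False⟩
  | finish (hret : ¬ c.returned) (hidle : ∀ i, ¬ (c.learner i).learning)
      (hfb : c.FeedbackFor P mc k fun _ => .none) :
      Config.Step P mc k c ⟨c.learner, True⟩

/-- `c` is reached by some run of the algorithm. -/
def Config.Reachable {M : Fin N → MDP Act AP} (P : ActionPartition M)
    (mc : ModelChecker Act AP N) (k : ℕ) (c : Config M) : Prop :=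
  Relation.ReflTransGen (Config.Step P mc k) (Config.initial M) c

end Algorithm

end SupSyn

namespace SupSyn

/-! ### Transitions, histories and schedulers. -/

namespace MDP

variable {Act AP : Type}

/-! Termination rests on there being only finitely many words of length at most `k` over the finite
alphabet of a subsystem. Every feedback uses up one of them. A positive counterexample is new to the
prefix set of the table: on table words of length at most `k` the supervisor of an idle learner
permits everything that the membership queries accept, so an old word would not be missing. A
negative counterexample is new among the negative ones: it is nonempty and permitted by the current
supervisor, which blocks all nonempty words already recorded there. Thus `Learner.deficit` drops in
each iteration that yields feedback.

Inside one L* call the answers are fixed, and every repair increases the number of distinct rows.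
This number is bounded because all words longer than `k` share one row, full of ones. As new
negative counterexamples change the answers and may merge rows, the two measures are combined
lexicographically in `Config.rank`; see `Config.Step.rank_lt`.

The algorithm is not stuck as long as a counterexample path has a selectable subsystem.
Well-communication provides one for every nonempty path (`ActionPartition.exists_selects`). An empty
path would mean that `ψ₂` holds initially under control; strict liveness is preserved when control
is dropped (`SubMap.sat`), so this contradicts the assumption on the initial state. The preservation
proof compares optimal values computed by backward induction and so avoids transferring schedulers.

Correctness is immediate: a return requires that nobody gets feedback, so the model checker found no
counterexample. -/

lemma sum_T_le_one (M : MDP Act AP) (s : M.State) (a : Act) : ∑ s', M.T s a s' ≤ 1 := by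
  rcases M.T_sum s a with h | h <;> simp [h]

lemma Enabled.mem_alphabet {M : MDP Act AP} {s : M.State} {a : Act} (h : M.Enabled s a) :
    a ∈ M.alphabet := by
  obtain ⟨s', hs'⟩ := h
  by_contra ha
  exact hs'.ne' (M.T_outside s a s' ha)

lemma enabled_of_sum_pos {M : MDP Act AP} {s : M.State} {a : Act} {g : M.State → ℝ}
    (h : 0 < ∑ s', M.T s a s' * g s') : M.Enabled s a := by
  by_contra hne
  simp only [Enabled, not_exists, not_lt] at hne
  refine h.ne' (Finset.sum_eq_zero fun s' _ => ?_)
  rw [le_antisymm (hne s') (M.T_nonneg _ _ _), zero_mul]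

@[simp] lemma History.last_nil {M : MDP Act AP} (s : M.State) :
    (⟨s, []⟩ : M.History).last = s := rfl

@[simp] lemma History.last_snoc {M : MDP Act AP} (h : M.History) (a : Act) (s : M.State) :
    (h.snoc a s).last = s := by
  simp [History.last, History.snoc, List.getLastD_eq_getLast?]

/-- A partial choice of enabled actions extends to a scheduler. -/
lemma exists_scheduler (M : MDP Act AP) (pref : M.History → Option Act)
    (hpref : ∀ h a, pref h = some a → M.Enabled h.last a) :
    ∃ σ : M.Scheduler, ∀ h a, pref h = some a → σ.choose h = some a := by
  classical
  have key : ∀ h : M.History, ∃ o : Option Act, (∀ a, o = some a → M.Enabled h.last a) ∧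
      (o = none → ∀ a, ¬ M.Enabled h.last a) ∧ ∀ a, pref h = some a → o = some a := by
    intro h
    cases hp : pref h with
    | some a =>
      refine ⟨some a, ?_, by simp, by simp⟩
      rintro b ⟨⟩
      exact hpref h a hp
    | none =>
      by_cases he : ∃ a, M.Enabled h.last a
      · obtain ⟨a, ha⟩ := he
        refine ⟨some a, ?_, by simp, by simp⟩
        rintro b ⟨⟩
        exact ha
      · exact ⟨none, by simp, fun _ a ha => he ⟨a, ha⟩, by simp⟩
  choose o h₁ h₂ h₃ using key
  exact ⟨⟨o, h₁, h₂⟩, h₃⟩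

/-! ### Optimal values of bounded until -/

open Classical in
/-- The maximal probability of `A U^{≤ k} B`, computed by backward induction. -/
noncomputable def value (M : MDP Act AP) (A B : M.State → Prop) : ℕ → M.State → ℝ
  | 0, s => if B s then 1 else 0
  | n + 1, s => if B s then 1 else if A s then
      ⨆ o : Option M.alphabet, o.elim 0 fun a => ∑ s', M.T s a s' * M.value A B n s' else 0

lemma value_of_right {M : MDP Act AP} {A B : M.State → Prop} {s : M.State} (h : B s) (n : ℕ) :
    M.value A B n s = 1 := by
  cases n <;> simp [value, h]

lemma value_nonneg (M : MDP Act AP) (A B : M.State → Prop) (n : ℕ) (s : M.State) :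
    0 ≤ M.value A B n s := by
  cases n with
  | zero => unfold value; split_ifs <;> norm_num
  | succ n =>
    unfold value
    split_ifs
    · norm_num
    · exact le_ciSup_of_le (Set.finite_range _).bddAbove none le_rfl
    · norm_num

lemma sum_T_mul_le_one (M : MDP Act AP) {g : M.State → ℝ} (hg : ∀ s, g s ≤ 1) (s : M.State)
    (a : Act) : ∑ s', M.T s a s' * g s' ≤ 1 :=
  (Finset.sum_le_sum fun s' _ => mul_le_of_le_one_right (M.T_nonneg s a s') (hg s')).trans
    (M.sum_T_le_one s a)

lemma value_le_one (M : MDP Act AP) (A B : M.State → Prop) (n : ℕ) (s : M.State) :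
    M.value A B n s ≤ 1 := by
  induction n generalizing s with
  | zero => unfold value; split_ifs <;> norm_num
  | succ n ih =>
    unfold value
    split_ifs
    · norm_num
    · refine ciSup_le fun o => ?_
      cases o with
      | none => exact zero_le_one
      | some a => exact M.sum_T_mul_le_one ih s a
    · norm_num

lemma le_value_succ {M : MDP Act AP} {A B : M.State → Prop} {s : M.State} (hA : A s) (n : ℕ)
    (a : Act) : ∑ s', M.T s a s' * M.value A B n s' ≤ M.value A B (n + 1) s := by
  by_cases hB : B s
  · rw [value_of_right hB]
    exact M.sum_T_mul_le_one (M.value_le_one A B n) s a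
  by_cases ha : a ∈ M.alphabet
  · rw [value, if_neg hB, if_pos hA]
    exact le_ciSup_of_le (Set.finite_range _).bddAbove (some ⟨a, ha⟩) le_rfl
  · refine le_trans (le_of_eq ?_) (M.value_nonneg A B _ s)
    exact Finset.sum_eq_zero fun s' _ => by rw [M.T_outside s a s' ha, zero_mul]

/-- The supremum is over a finite type, hence attained. Positivity rules out the dummy choice `none`
of value 0 and forces the maximizing action to be enabled. -/
lemma exists_value_succ_eq {M : MDP Act AP} {A B : M.State → Prop} {s : M.State} (hA : A s)
    (hB : ¬ B s) (n : ℕ) (hpos : 0 < M.value A B (n + 1) s) :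
    ∃ a, M.Enabled s a ∧ M.value A B (n + 1) s = ∑ s', M.T s a s' * M.value A B n s' := by
  have h : M.value A B (n + 1) s = ⨆ o : Option M.alphabet, o.elim 0 fun a =>
      ∑ s', M.T s a s' * M.value A B n s' := by rw [value, if_neg hB, if_pos hA]
  obtain ⟨o, ho⟩ := exists_eq_ciSup_of_finite (f := fun o : Option M.alphabet =>
    o.elim 0 fun a => ∑ s', M.T s a s' * M.value A B n s')
  rw [← ho] at h
  cases o with
  | none => simp [h] at hpos
  | some a => exact ⟨a, enabled_of_sum_pos (h ▸ hpos), h⟩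

/-! ### Probabilities of bounded until after a history -/

namespace Scheduler

variable {M : MDP Act AP}

open Classical in
/-- The probability of one step after the history `h`. -/
noncomputable def stepProb (σ : M.Scheduler) (h : M.History) (a : Act) (s' : M.State) : ℝ :=
  if σ.choose h = some a then M.T h.last a s' else 0

lemma sum_stepProb_of_some {σ : M.Scheduler} {h : M.History} {a : Act}
    (ha : σ.choose h = some a) (g : Act → M.State → ℝ) :
    ∑ b : M.alphabet, ∑ s', σ.stepProb h b s' * g b s' = ∑ s', M.T h.last a s' * g a s' := by
  have hmem := (σ.choose_enabled h a ha).mem_alphabet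
  rw [Finset.sum_eq_single ⟨a, hmem⟩]
  · simp [stepProb, ha]
  · intro b _ hb
    have : a ≠ b := fun h => hb (Subtype.ext h.symm)
    simp [stepProb, ha, this]
  · simp

lemma sum_stepProb_of_none {σ : M.Scheduler} {h : M.History}
    (ha : σ.choose h = none) (g : Act → M.State → ℝ) :
    ∑ b : M.alphabet, ∑ s', σ.stepProb h b s' * g b s' = 0 := by
  simp [stepProb, ha]

open Classical in
/-- The probability that the history `h` is continued by a minimal witness of `A U B` with exactly
`n` steps. -/
noncomputable def untilProbExact (σ : M.Scheduler) (A B : M.State → Prop) (h : M.History)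
    (n : ℕ) : ℝ :=
  ∑ r : Fin n → M.alphabet × M.State,
    let steps := List.ofFn fun t => ((r t).1.1, (r t).2)
    if M.UntilWitness A B h.last steps then σ.prob h steps else 0

/-- The probability of `A U^{≤ k} B` after the history `h`. -/
noncomputable def untilProbFrom (σ : M.Scheduler) (A B : M.State → Prop) (h : M.History)
    (k : ℕ) : ℝ :=
  ∑ n ∈ Finset.range (k + 1), σ.untilProbExact A B h n

open Classical in
lemma untilProbExact_zero (σ : M.Scheduler) (A B : M.State → Prop) (h : M.History) :
    σ.untilProbExact A B h 0 = if B h.last then 1 else 0 := by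
  simp [untilProbExact, UntilWitness, prob]

lemma untilWitness_ofFn_succ {A B : M.State → Prop} {s : M.State} {n : ℕ}
    (r : Fin (n + 1) → M.alphabet × M.State) :
    M.UntilWitness A B s (List.ofFn fun t => ((r t).1.1, (r t).2)) ↔ A s ∧ ¬ B s ∧
      M.UntilWitness A B (r 0).2 (List.ofFn fun t : Fin n => ((r t.succ).1.1, (r t.succ).2)) := by
  rw [List.ofFn_succ, UntilWitness]

lemma untilProbExact_succ_of_not (σ : M.Scheduler) {A B : M.State → Prop} {h : M.History}
    (hAB : ¬ (A h.last ∧ ¬ B h.last)) (n : ℕ) : σ.untilProbExact A B h (n + 1) = 0 := by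
  refine Finset.sum_eq_zero fun r _ => ?_
  refine if_neg fun h => hAB ?_
  rw [untilWitness_ofFn_succ] at h
  exact ⟨h.1, h.2.1⟩

lemma untilProbExact_succ (σ : M.Scheduler) {A B : M.State → Prop} {h : M.History}
    (hA : A h.last) (hB : ¬ B h.last) (n : ℕ) : σ.untilProbExact A B h (n + 1) =
      ∑ a : M.alphabet, ∑ s', σ.stepProb h a s' * σ.untilProbExact A B (h.snoc a s') n := by
  rw [untilProbExact, ← (Fin.consEquiv fun _ => M.alphabet × M.State).sum_comp,
    Fintype.sum_prod_type, Fintype.sum_prod_type]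
  refine Finset.sum_congr rfl fun a _ => Finset.sum_congr rfl fun s' _ => ?_
  rw [untilProbExact, Finset.mul_sum]
  refine Finset.sum_congr rfl fun r _ => ?_
  have hw : M.UntilWitness A B h.last (List.ofFn fun t =>
        (((Fin.cons (a, s') r : Fin (n + 1) → M.alphabet × M.State) t).1.1,
          ((Fin.cons (a, s') r : Fin (n + 1) → M.alphabet × M.State) t).2)) ↔
      M.UntilWitness A B (h.snoc a s').last (List.ofFn fun t => ((r t).1.1, (r t).2)) := by
    rw [untilWitness_ofFn_succ]
    simp [hA, hB]
  by_cases hr : M.UntilWitness A B (h.snoc a s').last (List.ofFn fun t => ((r t).1.1, (r t).2))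
  · refine (if_pos (hw.mpr hr)).trans ?_
    simp only [if_pos hr]
    simp [List.ofFn_succ, prob, stepProb, Fin.consEquiv]
  · refine (if_neg (mt hw.mp hr)).trans ?_
    simp only [if_neg hr, mul_zero]

lemma untilProbFrom_of_right (σ : M.Scheduler) {A B : M.State → Prop} {h : M.History}
    (hB : B h.last) (k : ℕ) : σ.untilProbFrom A B h k = 1 := by
  rw [untilProbFrom, Finset.sum_range_succ', Finset.sum_eq_zero, untilProbExact_zero, if_pos hB,
    zero_add]
  exact fun n _ => σ.untilProbExact_succ_of_not (fun h => h.2 hB) n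

lemma untilProbFrom_of_not (σ : M.Scheduler) {A B : M.State → Prop} {h : M.History}
    (hA : ¬ A h.last) (hB : ¬ B h.last) (k : ℕ) : σ.untilProbFrom A B h k = 0 := by
  rw [untilProbFrom, Finset.sum_range_succ', Finset.sum_eq_zero, untilProbExact_zero, if_neg hB,
    zero_add]
  exact fun n _ => σ.untilProbExact_succ_of_not (fun h => hA h.1) n

lemma untilProbFrom_zero (σ : M.Scheduler) {A B : M.State → Prop} {h : M.History}
    (hB : ¬ B h.last) : σ.untilProbFrom A B h 0 = 0 := by
  simp [untilProbFrom, untilProbExact_zero, hB]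

/-- The Bellman-type unfolding: the zero-step witness is impossible because `B` fails, and each
longer witness splits into its first step and a witness after the extended history. -/
lemma untilProbFrom_succ (σ : M.Scheduler) {A B : M.State → Prop} {h : M.History}
    (hA : A h.last) (hB : ¬ B h.last) (k : ℕ) : σ.untilProbFrom A B h (k + 1) =
      ∑ a : M.alphabet, ∑ s', σ.stepProb h a s' * σ.untilProbFrom A B (h.snoc a s') k := by
  rw [untilProbFrom, Finset.sum_range_succ', untilProbExact_zero, if_neg hB, add_zero]
  simp only [σ.untilProbExact_succ hA hB]
  rw [Finset.sum_comm]
  refine Finset.sum_congr rfl fun a _ => ?_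
  rw [Finset.sum_comm]
  simp only [untilProbFrom, Finset.mul_sum]

/-- The action chosen after `h` is one candidate in the supremum, and stopping yields 0. The
induction runs over all histories because `σ` may depend on the past. -/
lemma untilProbFrom_le_value (σ : M.Scheduler) (A B : M.State → Prop) (h : M.History) (k : ℕ) :
    σ.untilProbFrom A B h k ≤ M.value A B k h.last := by
  induction k generalizing h with
  | zero =>
    by_cases hB : B h.last
    · rw [σ.untilProbFrom_of_right hB, value_of_right hB]
    · rw [σ.untilProbFrom_zero hB]
      exact M.value_nonneg _ _ _ _
  | succ k ih =>
    by_cases hB : B h.last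
    · rw [σ.untilProbFrom_of_right hB, value_of_right hB]
    by_cases hA : A h.last
    · rw [σ.untilProbFrom_succ hA hB]
      cases hc : σ.choose h with
      | none =>
        rw [sum_stepProb_of_none hc fun a s' => σ.untilProbFrom A B (h.snoc a s') k]
        exact M.value_nonneg _ _ _ _
      | some a =>
        rw [sum_stepProb_of_some hc fun a s' => σ.untilProbFrom A B (h.snoc a s') k]
        refine le_trans (Finset.sum_le_sum fun s' _ => ?_) (le_value_succ hA k a)
        refine mul_le_mul_of_nonneg_left ?_ (M.T_nonneg _ _ _)
        simpa using ih (h.snoc a s')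
    · rw [σ.untilProbFrom_of_not hA hB]
      exact M.value_nonneg _ _ _ _

lemma untilProb_le_value (σ : M.Scheduler) (A B : M.State → Prop) (k : ℕ) (s : M.State) :
    σ.untilProb A B k s ≤ M.value A B k s :=
  σ.untilProbFrom_le_value A B ⟨s, []⟩ k

lemma untilProb_of_right (σ : M.Scheduler) {A B : M.State → Prop} {s : M.State} (h : B s)
    (k : ℕ) : σ.untilProb A B k s = 1 :=
  σ.untilProbFrom_of_right (h := ⟨s, []⟩) h k

lemma nextProb_of_some {σ : M.Scheduler} {s : M.State} {a : Act}
    (ha : σ.choose ⟨s, []⟩ = some a) (B : M.State → Prop) [DecidablePred B] :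
    σ.nextProb B s = ∑ s', M.T s a s' * if B s' then 1 else 0 := by
  classical
  have h := sum_stepProb_of_some ha fun _ s' => if B s' then (1 : ℝ) else 0
  rw [History.last_nil] at h
  rw [← h, nextProb, ← Finset.sum_coe_sort]
  refine Finset.sum_congr rfl fun b _ => Finset.sum_congr rfl fun s' _ => ?_
  by_cases hB : B s' <;> simp [hB, prob, stepProb]

lemma nextProb_of_none {σ : M.Scheduler} {s : M.State} (ha : σ.choose ⟨s, []⟩ = none)
    (B : M.State → Prop) : σ.nextProb B s = 0 := by
  simp [nextProb, prob, ha]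

end Scheduler

/-- The optimal value is attained by a scheduler. -/
lemma exists_scheduler_value_le (M : MDP Act AP) (A B : M.State → Prop) (k : ℕ) (s : M.State) :
    ∃ σ : M.Scheduler, M.value A B k s ≤ σ.untilProb A B k s := by
  classical
  -- The optimal action depends on the remaining number of steps, which is `k` minus the length of
  -- the history.
  have key : ∀ h : M.History, ∃ o : Option Act, (∀ a, o = some a → M.Enabled h.last a) ∧
      ∀ n, h.steps.length + (n + 1) = k → A h.last → ¬ B h.last →
        0 < M.value A B (n + 1) h.last → ∃ a, o = some a ∧
          M.value A B (n + 1) h.last = ∑ s', M.T h.last a s' * M.value A B n s' := by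
    intro h
    by_cases hn : ∃ n, h.steps.length + (n + 1) = k ∧ A h.last ∧ ¬ B h.last ∧
        0 < M.value A B (n + 1) h.last
    · obtain ⟨n, hn, hA, hB, hpos⟩ := hn
      obtain ⟨a, ha, hval⟩ := exists_value_succ_eq hA hB n hpos
      refine ⟨some a, ?_, ?_⟩
      · rintro b ⟨⟩
        exact ha
      · intro m hm _ _ _
        obtain rfl : m = n := by lia
        exact ⟨a, rfl, hval⟩
    · exact ⟨none, by simp, fun n h₁ h₂ h₃ h₄ => absurd ⟨n, h₁, h₂, h₃, h₄⟩ hn⟩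
  choose pref hpref hopt using key
  obtain ⟨σ, hσ⟩ := M.exists_scheduler pref hpref
  have nonneg : ∀ (n : ℕ) (h : M.History), 0 ≤ σ.untilProbFrom A B h n := by
    intro n
    induction n with
    | zero =>
      intro h
      by_cases hB : B h.last
      · rw [σ.untilProbFrom_of_right hB]; exact zero_le_one
      · rw [σ.untilProbFrom_zero hB]
    | succ n ih =>
      intro h
      by_cases hB : B h.last
      · rw [σ.untilProbFrom_of_right hB]; exact zero_le_one
      by_cases hA : A h.last
      · rw [σ.untilProbFrom_succ hA hB]
        refine Finset.sum_nonneg fun a _ => Finset.sum_nonneg fun s' _ => mul_nonneg ?_ (ih _)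
        unfold Scheduler.stepProb
        split_ifs
        · exact M.T_nonneg _ _ _
        · exact le_rfl
      · rw [σ.untilProbFrom_of_not hA hB]
  have main : ∀ (n : ℕ) (h : M.History), h.steps.length + n = k →
      M.value A B n h.last ≤ σ.untilProbFrom A B h n := by
    intro n
    induction n with
    | zero =>
      intro h _
      by_cases hB : B h.last
      · rw [σ.untilProbFrom_of_right hB, value_of_right hB]
      · rw [σ.untilProbFrom_zero hB, value, if_neg hB]
    | succ n ih =>
      intro h hlen
      by_cases hB : B h.last
      · rw [σ.untilProbFrom_of_right hB, value_of_right hB]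
      by_cases hA : A h.last
      -- At value 0 no action is prescribed, but then any continuation is good enough.
      · rcases (M.value_nonneg A B (n + 1) h.last).eq_or_lt with h0 | hpos
        · rw [← h0]
          exact nonneg _ _
        obtain ⟨a, ha, hval⟩ := hopt h n hlen hA hB hpos
        rw [σ.untilProbFrom_succ hA hB, Scheduler.sum_stepProb_of_some (hσ h a ha)
          fun a s' => σ.untilProbFrom A B (h.snoc a s') n, hval]
        refine Finset.sum_le_sum fun s' _ => mul_le_mul_of_nonneg_left ?_ (M.T_nonneg _ _ _)
        have := ih (h.snoc a s') (by simp [History.snoc]; lia)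
        rwa [History.last_snoc] at this
      · rw [σ.untilProbFrom_of_not hA hB, value, if_neg hB, if_neg hA]
  exact ⟨σ, main k ⟨s, []⟩ (by simp)⟩

/-! ### Preservation of strict liveness -/

/-- `f` maps the states of `M'` to those of `M` such that every action of `M'` either is disabled
or induces the distribution of the same action in `M`, or a smaller one. -/
structure SubMap (M' M : MDP Act AP) where
  toFun : M'.State → M.State
  label_subset : ∀ s, M'.label s ⊆ M.label (toFun s)
  sum_le : ∀ s a (g : M.State → ℝ), (∀ t, 0 ≤ g t) →
    ∑ s', M'.T s a s' * g (toFun s') ≤ ∑ t, M.T (toFun s) a t * g t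

namespace SubMap

variable {M' M : MDP Act AP}

/-- Backward induction: each candidate action in `M'` is dominated by the same action in `M`. Where
`B` holds in the image the value is already maximal, so only the other states need the induction. -/
lemma value_le (f : SubMap M' M) {A' B' : M'.State → Prop} {A B : M.State → Prop}
    (hA : ∀ s, A' s → A (f.toFun s)) (hB : ∀ s, B' s → B (f.toFun s)) (k : ℕ) (s : M'.State) :
    M'.value A' B' k s ≤ M.value A B k (f.toFun s) := by
  by_cases hBs : B (f.toFun s)
  · rw [value_of_right hBs]
    exact M'.value_le_one _ _ _ _
  have hBs' : ¬ B' s := fun h => hBs (hB s h)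
  induction k generalizing s with
  | zero => rw [value, value, if_neg hBs, if_neg hBs']
  | succ k ih =>
    by_cases hAs' : A' s
    · rw [value, if_neg hBs', if_pos hAs']
      refine ciSup_le fun o => ?_
      cases o with
      | none => exact M.value_nonneg _ _ _ _
      | some a =>
        refine le_trans (Finset.sum_le_sum fun s' _ => ?_)
          ((f.sum_le s a _ (M.value_nonneg A B k)).trans (le_value_succ (hA s hAs') k a))
        refine mul_le_mul_of_nonneg_left ?_ (M'.T_nonneg _ _ _)
        by_cases hBs₁ : B (f.toFun s')
        · rw [value_of_right hBs₁]
          exact M'.value_le_one _ _ _ _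
        · exact ih s' hBs₁ fun h => hBs₁ (hB s' h)
    · rw [value, if_neg hBs', if_neg hAs']
      exact M.value_nonneg _ _ _ _

/-- Strict liveness formulas are preserved. -/
theorem sat (f : SubMap M' M) (ψ : LiveFormula AP) (s : M'.State) (h : ψ.Sat M' s) :
    ψ.Sat M (f.toFun s) := by
  classical
  induction ψ generalizing s with
  | tt => trivial
  | atom a => exact f.label_subset s h
  | or ψ₁ ψ₂ ih₁ ih₂ => exact h.imp (ih₁ s) (ih₂ s)
  | and ψ₁ ψ₂ ih₁ ih₂ => exact h.imp (ih₁ s) (ih₂ s)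
  | notNext p ψ ih =>
    simp only [LiveFormula.Sat, not_forall, not_le] at h ⊢
    obtain ⟨σ', hσ'⟩ := h
    cases hc : σ'.choose ⟨s, []⟩ with
    | none =>
      rw [Scheduler.nextProb_of_none hc] at hσ'
      exact absurd hσ' (not_lt.mpr p.2.1)
    | some a =>
      rw [Scheduler.nextProb_of_some hc] at hσ'
      have hlt : (p : ℝ) < ∑ t, M.T (f.toFun s) a t * if ψ.Sat M t then 1 else 0 := by
        refine hσ'.trans_le (le_trans (Finset.sum_le_sum fun s' _ => ?_)
          (f.sum_le s a _ fun t => by split_ifs <;> norm_num))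
        refine mul_le_mul_of_nonneg_left ?_ (M'.T_nonneg _ _ _)
        by_cases hs' : ψ.Sat M' s'
        · rw [if_pos hs', if_pos (ih s' hs')]
        · rw [if_neg hs']
          split_ifs <;> norm_num
      -- A probability above `p ≥ 0` is positive, so `a` is enabled in `M` and may be prescribed as
      -- the first action.
      have hen := enabled_of_sum_pos (p.2.1.trans_lt hlt)
      obtain ⟨σ, hσ⟩ := M.exists_scheduler
        (fun h => if h = ⟨f.toFun s, []⟩ then some a else none) (by
          intro h b hb
          split_ifs at hb with hh
          cases hb
          rw [hh]
          exact hen)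
      exact ⟨σ, by rw [Scheduler.nextProb_of_some (hσ _ a (if_pos rfl))]; exact hlt⟩
  | notUntil p k ψ₁ ψ₂ ih₁ ih₂ =>
    simp only [LiveFormula.Sat, not_forall, not_le] at h ⊢
    obtain ⟨σ', hσ'⟩ := h
    obtain ⟨σ, hσ⟩ := M.exists_scheduler_value_le (fun t => ψ₁.Sat M t) (fun t => ψ₂.Sat M t) k
      (f.toFun s)
    -- Chain: probability under `σ'`, optimum in `M'`, optimum in `M`, probability under an optimal
    -- `σ`.
    exact ⟨σ, hσ'.trans_le ((σ'.untilProb_le_value _ _ k s).trans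
      ((f.value_le ih₁ ih₂ k s).trans hσ))⟩

end SubMap

/-- The controlled composition is mapped to the uncontrolled one by dropping the states of the
supervisors. -/
noncomputable def parallelSupMap {N : ℕ} (M : Fin N → MDP Act AP)
    (K : ∀ i, Automaton (M i).Letter) :
    SubMap (parallel fun i => (M i).sup (K i)) (parallel M) where
  toFun := fun s i => (s i).1
  label_subset := fun _ => subset_rfl
  sum_le := by
    classical
    intro s a g hg
    let e : (∀ i, (M i).State) × (∀ i, (K i).Q) ≃ ∀ i, (M i).State × (K i).Q :=
      { toFun := fun x i => (x.1 i, x.2 i)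
        invFun := fun y => (fun i => (y i).1, fun i => (y i).2)
        left_inv := fun _ => rfl
        right_inv := fun _ => rfl }
    change ∑ s' : ∀ i, (M i).State × (K i).Q, _ ≤ ∑ t : ∀ i, (M i).State, _
    rw [← e.sum_comp, Fintype.sum_prod_type]
    refine Finset.sum_le_sum fun t _ => ?_
    change ∑ q : ∀ i, (K i).Q, (parallel fun i => (M i).sup (K i)).T s a
      (fun i => (t i, q i)) * g t ≤ _
    rw [← Finset.sum_mul]
    refine mul_le_mul_of_nonneg_right ?_ (hg t)
    by_cases hex : ∃ i, a ∈ (M i).alphabet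
    · have hex' : ∃ i, a ∈ ((M i).sup (K i)).alphabet := hex
      simp only [parallel, if_pos hex, if_pos hex']
      -- Summing out the supervisor states factorizes over the components. In each factor at most
      -- one supervisor state contributes: the deterministic successor, or the unchanged state if
      -- the component does not move.
      have hsum := Finset.prod_univ_sum (fun i => (Finset.univ : Finset (K i).Q))
        (fun i q => if a ∈ ((M i).sup (K i)).alphabet then
          ((M i).sup (K i)).T (s i) a (t i, q) else if (t i, q) = s i then (1 : ℝ) else 0)
      rw [Fintype.piFinset_univ] at hsum
      refine (le_of_eq hsum.symm).trans (Finset.prod_le_prod ?_ ?_)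
      · refine fun i _ => Finset.sum_nonneg fun q _ => ?_
        split_ifs
        · exact ((M i).sup (K i)).T_nonneg _ _ _
        · exact zero_le_one
        · exact le_rfl
      · intro i _
        by_cases ha : a ∈ (M i).alphabet
        · have ha' : a ∈ ((M i).sup (K i)).alphabet := ha
          simp only [if_pos ha, sup, dif_pos ha]
          cases hq : (K i).δ (s i).2 ((s i).1, ⟨a, ha⟩) with
          | none => simpa using (M i).T_nonneg _ _ _
          | some q => simp
        · have ha' : a ∉ ((M i).sup (K i)).alphabet := ha
          simp only [if_neg ha', if_neg ha]
          by_cases ht : t i = (s i).1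
          · rw [if_pos ht, Finset.sum_eq_single (s i).2]
            · split_ifs <;> norm_num
            · intro q _ hq
              exact if_neg fun h => hq (congrArg Prod.snd h)
            · simp
          · rw [if_neg ht]
            refine le_of_eq (Finset.sum_eq_zero fun q _ => if_neg fun h => ht (congrArg Prod.fst h))
    · have hex' : ¬ ∃ i, a ∈ ((M i).sup (K i)).alphabet := hex
      simp [parallel, if_neg hex, if_neg hex']

end MDP

/-! ### Runs of partial automata -/

/-- The state reached from `q` by the word `w`, if the run is defined. -/
def Automaton.eval {Sym : Type} (K : Automaton Sym) : K.Q → List Sym → Option K.Q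
  | q, [] => some q
  | q, x :: w => (K.δ q x).bind fun q' => K.eval q' w

lemma Automaton.eval_all {Sym : Type} (q : (Automaton.all Sym).Q) (w : List Sym) :
    ((Automaton.all Sym).eval q w).isSome := by
  induction w with
  | nil => rfl
  | cons x w ih => exact ih

/-! ### Words of paths and their lifts to controlled systems. -/

namespace MDP

variable {Act AP : Type}

lemma mem_alphabet_of_T_pos {M : MDP Act AP} {s s' : M.State} {a : Act} (h : 0 < M.T s a s') :
    a ∈ M.alphabet :=
  Enabled.mem_alphabet ⟨s', h⟩

lemma word_cons {M : MDP Act AP} {s s' : M.State} {a : Act} {r : List (Act × M.State)}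
    (ha : a ∈ M.alphabet) : M.word s ((a, s') :: r) = (s, ⟨a, ha⟩) :: M.word s' r :=
  dif_pos ha

lemma exists_isPath_of_prefix_word (M : MDP Act AP) {s : M.State} {r : List (Act × M.State)}
    (hr : M.IsPath s r) {u : List M.Letter} (hu : u <+: M.word s r) :
    ∃ r', M.IsPath s r' ∧ M.word s r' = u := by
  induction r generalizing s u with
  | nil =>
    obtain rfl : u = [] := by simpa [word] using hu
    exact ⟨[], trivial, rfl⟩
  | cons x r ih =>
    obtain ⟨a, s'⟩ := x
    have ha := mem_alphabet_of_T_pos hr.1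
    cases u with
    | nil => exact ⟨[], trivial, rfl⟩
    | cons y u =>
      rw [word_cons ha, List.cons_prefix_cons] at hu
      obtain ⟨rfl, hu⟩ := hu
      obtain ⟨r', hr', hw⟩ := ih hr.2 hu
      exact ⟨(a, s') :: r', ⟨hr.1, hr'⟩, by rw [word_cons ha, hw]⟩

lemma mem_words_of_prefix (M : MDP Act AP) {u w : List M.Letter} (hw : w ∈ M.words)
    (hu : u <+: w) : u ∈ M.words := by
  obtain ⟨r, hr, rfl⟩ := hw
  exact M.exists_isPath_of_prefix_word hr hu

/-- A path whose word `K` can read is lifted by attaching the states of the deterministic run of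
`K`. -/
lemma exists_isPath_sup (M : MDP Act AP) (K : Automaton M.Letter) {s : M.State}
    {r : List (Act × M.State)} (hr : M.IsPath s r) {q : K.Q}
    (hq : (K.eval q (M.word s r)).isSome) :
    ∃ r', (M.sup K).IsPath (s, q) r' ∧ ((M.sup K).word (s, q) r').map
      (fun x : (M.State × K.Q) × M.alphabet => (x.1.1, x.2)) = M.word s r := by
  induction r generalizing s q with
  | nil => exact ⟨[], trivial, rfl⟩
  | cons x r ih =>
    obtain ⟨a, s'⟩ := x
    have ha := mem_alphabet_of_T_pos hr.1
    have ha' : a ∈ (M.sup K).alphabet := ha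
    rw [word_cons ha, Automaton.eval] at hq
    cases hδ : K.δ q (s, ⟨a, ha⟩) with
    | none => simp [hδ] at hq
    | some q' =>
      rw [hδ] at hq
      obtain ⟨r', hr', hw⟩ := ih hr.2 hq
      refine ⟨(a, (s', q')) :: r', ⟨?_, hr'⟩, ?_⟩
      · simpa [sup, ha, hδ] using hr.1
      · rw [word_cons ha, ← hw]
        exact congrArg _ (word_cons ha')

lemma mem_controlledWords (M : MDP Act AP) (K : Automaton M.Letter) {w : List M.Letter}
    (hw : w ∈ M.words) (h : (K.eval K.start w).isSome) : w ∈ M.controlledWords K := by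
  obtain ⟨r, hr, rfl⟩ := hw
  obtain ⟨r', hr', hw'⟩ := M.exists_isPath_sup K hr h
  exact ⟨_, ⟨r', hr', rfl⟩, hw'⟩

lemma Scheduler.isPath_of_prob_pos {M : MDP Act AP} (σ : M.Scheduler) {h : M.History}
    {r : List (Act × M.State)} (hr : 0 < σ.prob h r) : M.IsPath h.last r := by
  classical
  induction r generalizing h with
  | nil => trivial
  | cons x r ih =>
    obtain ⟨a, s'⟩ := x
    rw [prob] at hr
    split_ifs at hr with hc
    · have hT : 0 < M.T h.last a s' := by
        refine (M.T_nonneg _ _ _).lt_of_ne fun h0 => ?_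
        rw [← h0, zero_mul] at hr
        exact lt_irrefl _ hr
      have := ih (pos_of_mul_pos_right hr hT.le)
      refine ⟨hT, ?_⟩
      simpa [History.last, History.snoc, List.getLastD_eq_getLast?] using this
    · simp at hr

lemma parallel_T_pos {N : ℕ} {M : Fin N → MDP Act AP} {s s' : (parallel M).State} {a : Act}
    (h : 0 < (parallel M).T s a s') (i : Fin N) :
    (a ∈ (M i).alphabet → 0 < (M i).T (s i) a (s' i)) ∧
      (a ∉ (M i).alphabet → s' i = s i) := by
  classical
  simp only [parallel] at h
  split_ifs at h
  · have hi := (Finset.prod_ne_zero_iff.mp h.ne') i (Finset.mem_univ i)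
    constructor
    · intro ha
      rw [if_pos ha] at hi
      exact ((M i).T_nonneg _ _ _).lt_of_ne hi.symm
    · intro ha
      rw [if_neg ha] at hi
      by_contra hne
      exact hi (if_neg hne)
  · exact absurd h (lt_irrefl 0)

end MDP

/-! ### Projection of paths to a subsystem and selection of a subsystem. -/

section Project

variable {Act AP : Type} {N : ℕ} {M : Fin N → MDP Act AP}

lemma length_project_le (K : ∀ i, Automaton (M i).Letter) (j : Fin N)
    (s : ∀ i, (M i).State × (K i).Q) (r : List (Act × (∀ i, (M i).State × (K i).Q))) :
    (project K j s r).length ≤ r.length := by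
  induction r generalizing s with
  | nil => rfl
  | cons x r ih =>
    obtain ⟨a, s'⟩ := x
    rw [project]
    split_ifs
    · simpa using ih s'
    · exact (ih s').trans (Nat.le_succ _)

lemma project_ne_nil (K : ∀ i, Automaton (M i).Letter) (j : Fin N)
    (s : ∀ i, (M i).State × (K i).Q) (r : List (Act × (∀ i, (M i).State × (K i).Q))) {a : Act}
    (ha : a ∈ r.map Prod.fst) (haj : a ∈ (M j).alphabet) : project K j s r ≠ [] := by
  induction r generalizing s with
  | nil => simp at ha
  | cons x r ih =>
    obtain ⟨b, s'⟩ := x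
    rw [project]
    split_ifs with hb
    · simp
    · rw [List.map_cons, List.mem_cons] at ha
      refine ih s' (ha.resolve_left ?_)
      rintro rfl
      exact hb haj

/-- Along a path of the composition the supervisor of `j` moves exactly on the projected letters, so
it permits the projection. -/
lemma eval_project (K : ∀ i, Automaton (M i).Letter) (j : Fin N)
    (s : ∀ i, (M i).State × (K i).Q) (r : List (Act × (∀ i, (M i).State × (K i).Q)))
    (hr : (MDP.parallel fun i => (M i).sup (K i)).IsPath s r) :
    ((K j).eval (s j).2 (project K j s r)).isSome := by
  induction r generalizing s with
  | nil => rfl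
  | cons x r ih =>
    obtain ⟨a, s'⟩ := x
    obtain ⟨hT, hr⟩ := hr
    have hj := MDP.parallel_T_pos hT j
    rw [project]
    split_ifs with ha
    · have hpos := hj.1 ha
      simp only [MDP.sup, dif_pos ha] at hpos
      split_ifs at hpos with hδ
      · rw [Automaton.eval, hδ]
        exact ih s' hr
      · exact absurd hpos (lt_irrefl 0)
    · have heq : s' j = s j := hj.2 ha
      rw [← heq]
      exact ih s' hr

namespace ActionPartition

variable (P : ActionPartition M)

lemma mem_alphabet_iff (i : Fin N) (a : Act) :
    a ∈ (M i).alphabet ↔ (a ∈ P.active i ∨ a ∈ P.passive i) ∨ a ∈ P.normal i := by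
  have := Set.ext_iff.mp (P.union_eq i) a
  simpa using this.symm

lemma Selects.exists_mem_alphabet {P : ActionPartition M} {as : List Act} {i : Fin N}
    (h : P.Selects as i) : ∃ a ∈ as, a ∈ (M i).alphabet := by
  rcases h with ⟨u, a, v, rfl, ha, -⟩ | ⟨u, a, rfl, ha, -⟩
  · exact ⟨a, by simp, (P.mem_alphabet_iff i a).mpr (.inl (.inl ha))⟩
  · exact ⟨a, by simp, (P.mem_alphabet_iff i a).mpr (.inr ha)⟩

lemma exists_last_active {as : List Act} (h : ∃ a ∈ as, ∃ i, a ∈ P.active i) :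
    ∃ u a v i, as = u ++ a :: v ∧ a ∈ P.active i ∧ ∀ b ∈ v, ∀ j, b ∉ P.active j := by
  induction as with
  | nil => simp at h
  | cons b as ih =>
    by_cases has : ∃ a ∈ as, ∃ i, a ∈ P.active i
    · obtain ⟨u, a, v, i, rfl, hi, hv⟩ := ih has
      exact ⟨b :: u, a, v, i, rfl, hi, hv⟩
    · obtain ⟨a, ha, i, hi⟩ := h
      push Not at has
      rcases List.mem_cons.mp ha with rfl | ha
      · exact ⟨[], a, as, i, rfl, hi, fun b hb j => has b hb j⟩
      · exact absurd hi (has a ha i)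

/-- If no action is active anywhere, the last one cannot be passive either, since a passive action
is active elsewhere; hence it is normal for any subsystem having it. -/
lemma exists_selects (hP : P.WellCommunicated) {as : List Act} (hne : as ≠ [])
    (has : ∀ a ∈ as, ∃ i, a ∈ (M i).alphabet) : ∃ i, P.Selects as i := by
  by_cases hact : ∃ a ∈ as, ∃ i, a ∈ P.active i
  · obtain ⟨u, a, v, i, h⟩ := P.exists_last_active hact
    exact ⟨i, .inl ⟨u, a, v, h⟩⟩
  · push Not at hact
    have hmem := as.getLast_mem hne
    obtain ⟨i, hi⟩ := has _ hmem
    refine ⟨i, .inr ⟨as.dropLast, as.getLast hne, (List.dropLast_concat_getLast hne).symm, ?_,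
      hact _ hmem⟩⟩
    rcases (P.mem_alphabet_iff i _).mp hi with (h | h) | h
    · exact absurd h (hact _ hmem i)
    · obtain ⟨j, ⟨-, hj⟩, -⟩ := hP.2 i _ h
      exact absurd hj (hact _ hmem j)
    · exact h

end ActionPartition

end Project

/-! ### Observation tables -/

namespace Table

variable {Sym : Type} {t : Table Sym} {L : Set (List Sym)}

lemma mem_row {s e : List Sym} : e ∈ t.row L s ↔ e ∈ t.E ∧ s ++ e ∈ L := by
  simp [row]

/-- The state of the conjectured automaton that belongs to the row of `s`. -/
noncomputable def rowState (t : Table Sym) (L : Set (List Sym)) (s : List Sym) (hs : s ∈ t.S) :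
    (t.conjecture L).trim.Q :=
  ⟨t.row L s, by classical exact Finset.mem_image_of_mem _ hs⟩

/-- The suffix `[]` records the answer for `s` in its row, so acceptance does not depend on the
representative. -/
lemma rowState_mem_accept (hE : [] ∈ t.E) {s : List Sym} (hs : s ∈ t.S) :
    t.rowState L s hs ∈ (t.conjecture L).accept ↔ s ∈ L := by
  constructor
  · rintro ⟨s', -, hrow, hs'⟩
    have hmem : [] ∈ t.row L s' := mem_row.mpr ⟨hE, by simpa using hs'⟩
    have hrow : t.row L s' = t.row L s := hrow
    rw [hrow, mem_row] at hmem
    simpa using hmem.2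
  · exact fun h => ⟨s, hs, rfl, h⟩

/-- Consistency makes the successor row independent of the representative chosen in the conjecture.
-/
lemma conjecture_δ (hco : t.Consistent L) {s : List Sym} {x : Sym} (hs : s ∈ t.S)
    (hsx : s ++ [x] ∈ t.S) :
    (t.conjecture L).δ (t.rowState L s hs) x = some (t.rowState L (s ++ [x]) hsx) := by
  classical
  have hspec := (Finset.mem_image.mp (t.rowState L s hs).2).choose_spec
  have hrow := hco _ hspec.1 s hs hspec.2 x
  have hmem := Finset.mem_image_of_mem (t.row L) hsx
  rw [← hrow] at hmem
  refine (dif_pos hmem).trans (congrArg some (Subtype.ext hrow))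

open Classical in
lemma conjecture_trim_δ (hE : [] ∈ t.E) (hco : t.Consistent L) {s : List Sym} {x : Sym}
    (hs : s ∈ t.S) (hsx : s ++ [x] ∈ t.S) :
    (t.conjecture L).trim.δ (t.rowState L s hs) x =
      if s ++ [x] ∈ L then some (t.rowState L (s ++ [x]) hsx) else none := by
  have h := rowState_mem_accept (L := L) hE hsx
  simp only [Automaton.trim, conjecture_δ hco hs hsx, Option.filter, decide_eq_true_eq]
  by_cases hL : s ++ [x] ∈ L
  · exact (if_pos (h.mpr hL)).trans (if_pos hL).symm
  · exact (if_neg (mt h.mp hL)).trans (if_neg hL).symm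

lemma eval_conjecture_trim (hE : [] ∈ t.E) (hco : t.Consistent L) {w s : List Sym}
    (hs : s ∈ t.S) (hw : ∀ u, u <+: w → s ++ u ∈ t.S ∧ s ++ u ∈ L) :
    ((t.conjecture L).trim.eval (t.rowState L s hs) w).isSome := by
  induction w generalizing s with
  | nil => rfl
  | cons x w ih =>
    obtain ⟨hS, hL⟩ := hw [x] ⟨w, rfl⟩
    rw [Automaton.eval, conjecture_trim_δ hE hco hs hS, if_pos hL]
    refine ih hS fun u hu => ?_
    simpa using hw (x :: u) (List.cons_prefix_cons.mpr ⟨rfl, hu⟩)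

/-- As long as its prefixes lie in the table, a word leads to its own row, and trimming blocks it on
entering a rejected one. The empty word is excluded: trimming removes only transitions, so its run
always exists. -/
lemma mem_of_eval_conjecture_trim (hE : [] ∈ t.E) (hco : t.Consistent L) {w s : List Sym}
    (hs : s ∈ t.S) (hw : ∀ u, u <+: w → s ++ u ∈ t.S) (hne : w ≠ [])
    (heval : ((t.conjecture L).trim.eval (t.rowState L s hs) w).isSome) : s ++ w ∈ L := by
  induction w generalizing s with
  | nil => exact absurd rfl hne
  | cons x w ih =>
    have hS := hw [x] ⟨w, rfl⟩
    rw [Automaton.eval, conjecture_trim_δ hE hco hs hS] at heval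
    split_ifs at heval with hL
    · cases w with
      | nil => exact hL
      | cons y w =>
        have := ih hS (fun u hu => by
          simpa using hw (x :: u) (List.cons_prefix_cons.mpr ⟨rfl, hu⟩)) (by simp) heval
        simpa using this
    · simp at heval

open Classical in
/-- The number of different rows of the elements of `S`. -/
noncomputable def numRows (t : Table Sym) (L : Set (List Sym)) : ℕ := (t.S.image (t.row L)).card

lemma numRows_le_of_row_eq (t : Table Sym) (W : Finset (List Sym))
    (h : ∀ s ∉ W, t.row L s = t.E) : t.numRows L ≤ W.card + 1 := by
  classical
  have hsub : t.S.image (t.row L) ⊆ insert t.E (W.image (t.row L)) := by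
    intro y hy
    obtain ⟨s, -, rfl⟩ := Finset.mem_image.mp hy
    by_cases hs : s ∈ W
    · exact Finset.mem_insert_of_mem (Finset.mem_image_of_mem _ hs)
    · rw [h s hs]
      exact Finset.mem_insert_self _ _
  exact (Finset.card_le_card hsub).trans ((Finset.card_insert_le _ _).trans
    (Nat.succ_le_succ Finset.card_image_le))

lemma mem_addCounterexample_iff {v w : List Sym} :
    w ∈ (t.addCounterexample v).S ↔ w ∈ t.S ∨ w <+: v := by
  simp [addCounterexample]

lemma prefix_closed_addCounterexample (ht : ∀ u w, u <+: w → w ∈ t.S → u ∈ t.S)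
    (v : List Sym) :
    ∀ u w, u <+: w → w ∈ (t.addCounterexample v).S → u ∈ (t.addCounterexample v).S := by
  intro u w hu hw
  rw [mem_addCounterexample_iff] at hw ⊢
  exact hw.imp (ht u w hu) hu.trans

lemma mem_addCounterexample (t : Table Sym) (v : List Sym) : v ∈ (t.addCounterexample v).S :=
  mem_addCounterexample_iff.mpr (.inr (List.prefix_refl v))

lemma subset_addCounterexample (t : Table Sym) (v : List Sym) :
    t.S ⊆ (t.addCounterexample v).S :=
  fun _ h => mem_addCounterexample_iff.mpr (.inl h)

/-- Closing adds a row not seen before. A new suffix refines the partition into rows and separates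
two prefixes whose rows agreed. -/
lemma Repair.numRows_lt {t' : Table Sym} (h : Repair L t t') : t.numRows L < t'.numRows L := by
  classical
  cases h with
  | close s x hs h =>
    have heq : (t.addPrefix (s ++ [x])).S.image ((t.addPrefix (s ++ [x])).row L) =
        insert (t.row L (s ++ [x])) (t.S.image (t.row L)) := by
      ext y
      simp only [addPrefix, Finset.image_insert]
      rfl
    rw [numRows, numRows, heq, Finset.card_insert_of_notMem]
    · exact Nat.lt_succ_self _
    · simpa using h
  | makeConsistent s₁ s₂ x e h₁ h₂ hrow he hne =>
    set t' := t.addSuffix (x :: e)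
    have hfilter : ∀ s, t.row L s = (t'.row L s).filter (· ∈ t.E) := by
      intro s
      ext y
      simp only [Finset.mem_filter, mem_row]
      constructor
      · exact fun h => ⟨⟨Finset.mem_insert_of_mem h.1, h.2⟩, h.1⟩
      · exact fun h => ⟨h.2, h.1.2⟩
    have himage : t.S.image (t.row L) = (t'.S.image (t'.row L)).image
        (fun y => y.filter (· ∈ t.E)) := by
      rw [Finset.image_image]
      exact Finset.image_congr fun s _ => hfilter s
    rw [numRows, numRows, himage]
    -- Restriction to the old suffixes maps new rows onto old rows; equal cardinalities would make
    -- it injective, identifying the rows of `s₁` and `s₂` even at `x :: e`.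
    refine Finset.card_image_le.lt_of_ne fun hcard => hne ?_
    have hrow' : t'.row L s₁ = t'.row L s₂ := by
      refine Finset.card_image_iff.mp hcard (Finset.mem_coe.mpr (Finset.mem_image_of_mem _ h₁))
        (Finset.mem_coe.mpr (Finset.mem_image_of_mem _ h₂)) ?_
      simpa only [← hfilter] using hrow
    have hxe : x :: e ∈ t'.E := Finset.mem_insert_self _ _
    have := Finset.ext_iff.mp hrow' (x :: e)
    simpa [mem_row, hxe] using this

lemma Repair.S_subset {t' : Table Sym} (h : Repair L t t') : t.S ⊆ t'.S := by
  classical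
  cases h with
  | close => exact Finset.subset_insert _ _
  | makeConsistent => exact subset_rfl

lemma Repair.nil_mem_E {t' : Table Sym} (h : Repair L t t') (hE : [] ∈ t.E) : [] ∈ t'.E := by
  classical
  cases h with
  | close => exact hE
  | makeConsistent => exact Finset.mem_insert_of_mem hE

lemma Repair.prefix_closed {t' : Table Sym} (h : Repair L t t')
    (ht : ∀ u w, u <+: w → w ∈ t.S → u ∈ t.S) : ∀ u w, u <+: w → w ∈ t'.S → u ∈ t'.S := by
  classical
  cases h with
  | close s x hs =>
    intro u w hu hw
    rcases Finset.mem_insert.mp hw with rfl | hw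
    · rcases List.prefix_concat_iff.mp hu with rfl | hu
      · exact Finset.mem_insert_self _ _
      · exact Finset.mem_insert_of_mem (ht u s hu hs)
    · exact Finset.mem_insert_of_mem (ht u w hu hw)
  | makeConsistent => exact ht

lemma exists_repair (h : ¬ (t.Closed L ∧ t.Consistent L)) : ∃ t', Repair L t t' := by
  by_cases hcl : t.Closed L
  · have hco : ¬ t.Consistent L := fun hco => h ⟨hcl, hco⟩
    simp only [Consistent, not_forall] at hco
    obtain ⟨s₁, h₁, s₂, h₂, hrow, x, hne⟩ := hco
    rw [Finset.ext_iff, not_forall] at hne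
    obtain ⟨e, hne⟩ := hne
    simp only [mem_row] at hne
    have he : e ∈ t.E := by
      by_contra he
      simp [he] at hne
    exact ⟨_, .makeConsistent s₁ s₂ x e h₁ h₂ hrow he fun hiff => hne (and_congr_right' hiff)⟩
  · simp only [Closed, not_forall, not_exists, not_and] at hcl
    obtain ⟨s, hs, x, hx⟩ := hcl
    exact ⟨_, .close s x hs hx⟩

end Table

/-! ### Invariants and progress of a learner -/

section Learner

variable {Act AP : Type} {M : MDP Act AP} {k : ℕ}

/-- The length bound matters: words longer than `k` are accepted regardless of their prefixes. -/
lemma target_of_prefix {C : Finset (List M.Letter)} {u w : List M.Letter} (hlen : w.length ≤ k)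
    (hw : w ∈ target M k C) (hu : u <+: w) : u ∈ target M k C := by
  rcases hw with hw | ⟨hw, hC⟩
  · exact absurd hw (not_lt.mpr hlen)
  · exact .inr ⟨M.mem_words_of_prefix hw hu, fun c hc hcu => hC c hc (hcu.trans hu)⟩

/-- The words of length at most `k`. -/
noncomputable def shortWords (M : MDP Act AP) (k : ℕ) : Finset (List M.Letter) :=
  (List.finite_length_le M.Letter k).toFinset

@[simp] lemma mem_shortWords {w : List M.Letter} : w ∈ shortWords M k ↔ w.length ≤ k := by
  simp [shortWords]

/-- Every extension of a word longer than `k` is accepted, so all such words together contribute one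
row. -/
lemma Table.numRows_target_le (t : Table M.Letter) (C : Finset (List M.Letter)) :
    t.numRows (target M k C) ≤ (shortWords M k).card + 1 := by
  refine t.numRows_le_of_row_eq _ fun s hs => ?_
  rw [mem_shortWords, not_le] at hs
  ext e
  rw [Table.mem_row]
  refine and_iff_left_of_imp fun _ => .inl ?_
  rw [List.length_append]
  lia

/-- The invariants of a learner. When it is idle, its supervisor agrees with the answers to the
membership queries for the prefixes of its table that are not longer than `k`. -/
structure Learner.Inv (k : ℕ) (l : Learner M) : Prop where
  prefix_closed : ∀ u w, u <+: w → w ∈ l.table.S → u ∈ l.table.S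
  nil_mem : [] ∈ l.table.E
  negatives_subset : l.negatives ⊆ l.table.S
  negatives_short : ∀ w ∈ l.negatives, w.length ≤ k
  allowed : ¬ l.learning → ∀ w ∈ l.table.S, w.length ≤ k → w ∈ target M k l.negatives →
    (l.K.eval l.K.start w).isSome
  forbidden : ¬ l.learning → ∀ w ∈ l.negatives, w ≠ [] → ¬ (l.K.eval l.K.start w).isSome

namespace Learner

variable {l l' : Learner M}

lemma inv_initial :
    Inv k (⟨Table.initial _, ∅, Automaton.all _, False⟩ : Learner M) where
  prefix_closed := by
    intro u w hu hw
    obtain rfl : w = [] := by simpa [Table.initial] using hw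
    rwa [List.prefix_nil.mp hu]
  nil_mem := by simp [Table.initial]
  negatives_subset := Finset.empty_subset _
  negatives_short := by simp
  allowed := fun _ w _ _ _ => Automaton.eval_all _ w
  forbidden := by simp

/-- Only a conjecture has to establish agreement with the answers. It does so on the table words,
which are prefix-closed and include the negative counterexamples. -/
lemma Inv.step (hl : Inv k l) (h : Step k l l') : Inv k l' := by
  cases h with
  | repair h t ht =>
    exact ⟨ht.prefix_closed hl.prefix_closed, ht.nil_mem_E hl.nil_mem,
      hl.negatives_subset.trans ht.S_subset, hl.negatives_short,
      fun h => absurd trivial h, fun h => absurd trivial h⟩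
  | conjecture h hcl hco =>
    refine ⟨hl.prefix_closed, hl.nil_mem, hl.negatives_subset, hl.negatives_short, ?_, ?_⟩
    · intro _ w hw hlen hL
      exact Table.eval_conjecture_trim hl.nil_mem hco l.table.nil_mem fun u hu =>
        ⟨hl.prefix_closed u w hu hw, target_of_prefix hlen hL hu⟩
    · intro _ w hw hne heval
      have hL := Table.mem_of_eval_conjecture_trim hl.nil_mem hco l.table.nil_mem
        (fun u hu => hl.prefix_closed u w hu (hl.negatives_subset hw)) hne heval
      rcases hL with hL | ⟨-, hL⟩
      · exact absurd hL (not_lt.mpr (hl.negatives_short w hw))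
      · exact hL w hw (List.prefix_refl w)

lemma Inv.receive (hl : Inv k l) (fb : Feedback M.Letter)
    (hfb : ∀ w, fb = .negative w → w.length ≤ k) : Inv k (l.receive fb) := by
  classical
  cases fb with
  | none => exact hl
  | positive w =>
    exact ⟨Table.prefix_closed_addCounterexample hl.prefix_closed w, hl.nil_mem,
      hl.negatives_subset.trans (Table.subset_addCounterexample _ _), hl.negatives_short,
      fun h => absurd trivial h, fun h => absurd trivial h⟩
  | negative w =>
    refine ⟨Table.prefix_closed_addCounterexample hl.prefix_closed w, hl.nil_mem, ?_, ?_,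
      fun h => absurd trivial h, fun h => absurd trivial h⟩
    · exact Finset.insert_subset (Table.mem_addCounterexample _ _)
        (hl.negatives_subset.trans (Table.subset_addCounterexample _ _))
    · intro v hv
      rcases Finset.mem_insert.mp hv with rfl | hv
      · exact hfb v rfl
      · exact hl.negatives_short v hv

open Classical in
/-- A bound for the number of counterexamples that the learner can still receive. -/
noncomputable def deficit (k : ℕ) (l : Learner M) : ℕ :=
  (shortWords M k \ l.table.S).card + (shortWords M k \ l.negatives).card

open Classical in
/-- A bound for the number of steps of the current call of the learner. -/
noncomputable def pending (k : ℕ) (l : Learner M) : ℕ :=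
  if l.learning then (shortWords M k).card + 2 - l.table.numRows (target M k l.negatives) else 0

lemma Step.deficit_le (h : Step k l l') : l'.deficit k ≤ l.deficit k := by
  classical
  cases h with
  | repair h t ht =>
    exact Nat.add_le_add_right (Finset.card_le_card (Finset.sdiff_subset_sdiff subset_rfl
      ht.S_subset)) _
  | conjecture => exact le_rfl

/-- The answers do not change during a call. In the summand 2 of `pending`, one unit belongs to the
bound on the rows and one keeps the measure positive until the conjecture resets it to 0. -/
lemma Step.pending_lt (h : Step k l l') : l'.pending k < l.pending k := by
  classical
  have hle := l.table.numRows_target_le (k := k) l.negatives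
  cases h with
  | repair h t ht =>
    have hlt := ht.numRows_lt
    simp only [pending, if_pos h, if_true]
    lia
  | conjecture h hcl hco =>
    simp only [pending, if_pos h, if_false]
    lia

lemma receive_deficit_le (l : Learner M) (fb : Feedback M.Letter) :
    (l.receive fb).deficit k ≤ l.deficit k := by
  classical
  cases fb with
  | none => exact le_rfl
  | positive w =>
    exact Nat.add_le_add_right (Finset.card_le_card (Finset.sdiff_subset_sdiff subset_rfl
      (Table.subset_addCounterexample _ _))) _
  | negative w =>
    exact Nat.add_le_add (Finset.card_le_card (Finset.sdiff_subset_sdiff subset_rfl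
      (Table.subset_addCounterexample _ _))) (Finset.card_le_card (Finset.sdiff_subset_sdiff subset_rfl
      (Finset.subset_insert _ _)))

lemma card_sdiff_lt {α : Type*} [DecidableEq α] {W A B : Finset α} (h : A ⊆ B) {w : α}
    (hW : w ∈ W) (hA : w ∉ A) (hB : w ∈ B) : (W \ B).card < (W \ A).card := by
  refine Finset.card_lt_card (Finset.ssubset_iff_of_subset
    (Finset.sdiff_subset_sdiff subset_rfl h) |>.mpr ⟨w, ?_, ?_⟩) <;> simp [*]

lemma receive_positive_deficit_lt (hl : Inv k l) (hidle : ¬ l.learning) {w : List M.Letter}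
    (hw : l.IsPositive k w) : (l.receive (.positive w)).deficit k < l.deficit k := by
  classical
  obtain ⟨hlen, hwords, hnot, hneg⟩ := hw
  refine Nat.add_lt_add_right (card_sdiff_lt (Table.subset_addCounterexample _ _)
    (mem_shortWords.mpr hlen) (fun hS => hnot ?_) (Table.mem_addCounterexample _ w)) _
  exact M.mem_controlledWords _ hwords (hl.allowed hidle w hS hlen (.inr ⟨hwords, hneg⟩))

/-- The word may already be in the table, so the strict decrease comes from the set of negative
counterexamples, whose nonempty members the supervisor blocks. -/
lemma receive_negative_deficit_lt (hl : Inv k l) (hidle : ¬ l.learning) {w : List M.Letter}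
    (hlen : w.length ≤ k) (hne : w ≠ []) (hw : (l.K.eval l.K.start w).isSome) :
    (l.receive (.negative w)).deficit k < l.deficit k := by
  classical
  refine Nat.add_lt_add_of_le_of_lt (Finset.card_le_card (Finset.sdiff_subset_sdiff subset_rfl
    (Table.subset_addCounterexample _ _))) (card_sdiff_lt (Finset.subset_insert _ _)
    (mem_shortWords.mpr hlen) (fun hC => hl.forbidden hidle w hC hne hw)
    (Finset.mem_insert_self _ _))

lemma exists_step (h : l.learning) : ∃ l', Step k l l' := by
  by_cases ht : l.table.Closed (target M k l.negatives) ∧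
      l.table.Consistent (target M k l.negatives)
  · exact ⟨_, .conjecture h ht.1 ht.2⟩
  · obtain ⟨t, ht⟩ := Table.exists_repair ht
    exact ⟨_, .repair h t ht⟩

lemma exists_positiveFeedback (l : Learner M) (k : ℕ) : ∃ fb, l.PositiveFeedback k fb := by
  by_cases h : ∃ w, l.IsPositive k w
  · obtain ⟨w, hw⟩ := h
    exact ⟨.positive w, hw⟩
  · exact ⟨.none, not_exists.mp h⟩

end Learner

end Learner

/-! ### Runs of the synthesis algorithm -/

section Algorithm

variable {Act AP : Type} {N : ℕ} {M : Fin N → MDP Act AP} {P : ActionPartition M}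
  {mc : ModelChecker Act AP N} {k : ℕ} {c c' : Config M}

/-- An empty counterexample would witness `ψ₂` initially, already without control. -/
lemma IsCounterexample.ne_nil {p : unitInterval} {ψ₁ ψ₂ : LiveFormula AP}
    (K : ∀ i, Automaton (M i).Letter)
    (hinit : (p : ℝ) < 1 → ¬ ψ₂.Sat (MDP.parallel M) (MDP.parallel M).init)
    {r : List (Act × (MDP.parallel fun i => (M i).sup (K i)).State)}
    (h : IsCounterexample (MDP.parallel fun i => (M i).sup (K i)) p k ψ₁ ψ₂ r) : r ≠ [] := by
  rintro rfl
  obtain ⟨σ, hlt, -, hw, -⟩ := h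
  have hψ : ψ₂.Sat (MDP.parallel fun i => (M i).sup (K i))
    (MDP.parallel fun i => (M i).sup (K i)).init := hw
  -- The probability is 1 here, so the violated bound gives `p < 1`, as the initial-state assumption
  -- requires.
  rw [σ.untilProb_of_right hψ] at hlt
  exact hinit hlt ((MDP.parallelSupMap M K).sat ψ₂ _ hψ)

lemma IsCounterexample.isPath {C : MDP Act AP} {p : unitInterval} {ψ₁ ψ₂ : LiveFormula AP}
    {r : List (Act × C.State)} (h : IsCounterexample C p k ψ₁ ψ₂ r) : C.IsPath C.init r := by
  obtain ⟨σ, -, -, -, hpos⟩ := h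
  exact σ.isPath_of_prob_pos hpos

lemma MDP.IsPath.mem_alphabet {C : MDP Act AP} {s : C.State} {r : List (Act × C.State)}
    (h : C.IsPath s r) {a : Act} (ha : a ∈ r.map Prod.fst) : a ∈ C.alphabet := by
  induction r generalizing s with
  | nil => simp at ha
  | cons x r ih =>
    obtain ⟨b, s'⟩ := x
    rw [List.map_cons, List.mem_cons] at ha
    rcases ha with rfl | ha
    · exact mem_alphabet_of_T_pos h.1
    · exact ih h.2 ha

namespace Config

/-- The invariants of all learners. -/
def Inv (k : ℕ) (c : Config M) : Prop := ∀ i, (c.learner i).Inv k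

section

variable {p : unitInterval} {ψ₁ ψ₂ : LiveFormula AP} {fb : ∀ i, Feedback (M i).Letter}

/-- A negative counterexample is a nonempty word of length at most `k` which the supervisor of the
selected subsystem permits. -/
lemma FeedbackFor.negative (hmc : mc.SoundComplete p k ψ₁ ψ₂) (h : c.FeedbackFor P mc k fb)
    {i : Fin N} {w : List (M i).Letter} (hw : fb i = .negative w) :
    w.length ≤ k ∧ w ≠ [] ∧ ((c.learner i).K.eval (c.learner i).K.start w).isSome := by
  rcases h with ⟨-, hpos⟩ | ⟨r, hr, j, hj, hneg, hpos⟩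
  · have := hpos i
    rw [hw] at this
    exact this.elim
  · obtain rfl : i = j := by
      by_contra hij
      have := hpos i hij
      rw [hw] at this
      exact this
    have hcex := (hmc c.components).2 r hr
    obtain ⟨σ, -, hlen, -, -⟩ := id hcex
    rw [hw] at hneg
    cases hneg
    obtain ⟨a, ha, hai⟩ := hj.exists_mem_alphabet
    exact ⟨(length_project_le _ i _ r).trans hlen, project_ne_nil _ i _ r ha hai,
      eval_project _ i _ r hcex.isPath⟩

lemma FeedbackFor.positive (h : c.FeedbackFor P mc k fb) {i : Fin N} {w : List (M i).Letter}
    (hw : fb i = .positive w) : (c.learner i).IsPositive k w := by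
  rcases h with ⟨-, hpos⟩ | ⟨r, hr, j, hj, hneg, hpos⟩
  · simpa [hw, Learner.PositiveFeedback] using hpos i
  · have hij : i ≠ j := by
      rintro rfl
      rw [hw] at hneg
      cases hneg
    simpa [hw, Learner.PositiveFeedback] using hpos i hij

lemma Inv.step (hmc : mc.SoundComplete p k ψ₁ ψ₂) (hc : c.Inv k) (h : Step P mc k c c') :
    c'.Inv k := by
  cases h with
  | learn hret i l h =>
    intro j
    by_cases hj : j = i
    · subst hj
      simpa using (hc j).step h
    · simpa [hj] using hc j
  | refine hret hidle fb hfb hex =>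
    exact fun i => (hc i).receive (fb i) fun w hw => (hfb.negative hmc hw).1
  | finish => exact hc

lemma Reachable.inv (hmc : mc.SoundComplete p k ψ₁ ψ₂) (h : Reachable P mc k c) : c.Inv k := by
  induction h with
  | refl => exact fun _ => Learner.inv_initial
  | tail _ h ih => exact ih.step hmc h

/-- The termination measure: the counterexamples that are still possible, and the steps of the
learners until the next iteration. -/
noncomputable def rank (k : ℕ) (c : Config M) : ℕ ×ₗ ℕ :=
  toLex (∑ i, (c.learner i).deficit k, ∑ i, (c.learner i).pending k)

/-- Learner steps lower the second component without raising the first. Feedback lowers the first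
and may raise the second, since it starts new calls. -/
lemma Step.rank_lt (hmc : mc.SoundComplete p k ψ₁ ψ₂) (hc : c.Inv k) (h : Step P mc k c c')
    (hret : ¬ c'.returned) : c'.rank k < c.rank k := by
  rw [rank, rank, Prod.Lex.toLex_lt_toLex]
  cases h with
  | learn _ i l h =>
    have hpend : ∑ j, (Function.update c.learner i l j).pending k <
        ∑ j, (c.learner j).pending k := by
      refine Finset.sum_lt_sum (fun j _ => ?_) ⟨i, Finset.mem_univ i, by simpa using h.pending_lt⟩
      by_cases hj : j = i
      · subst hj
        simpa using h.pending_lt.le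
      · simp [hj]
    have hdef : ∑ j, (Function.update c.learner i l j).deficit k ≤
        ∑ j, (c.learner j).deficit k := by
      refine Finset.sum_le_sum fun j _ => ?_
      by_cases hj : j = i
      · subst hj
        simpa using h.deficit_le
      · simp [hj]
    exact hdef.lt_or_eq.imp id fun h => ⟨h, hpend⟩
  | refine _ hidle fb hfb hex =>
    obtain ⟨i, hi⟩ := hex
    refine .inl (Finset.sum_lt_sum (fun j _ => Learner.receive_deficit_le _ _)
      ⟨i, Finset.mem_univ i, ?_⟩)
    cases hw : fb i with
    | none => exact absurd hw hi
    | positive w => exact Learner.receive_positive_deficit_lt (hc i) (hidle i) (hfb.positive hw)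
    | negative w =>
      obtain ⟨hlen, hne, heval⟩ := hfb.negative hmc hw
      exact Learner.receive_negative_deficit_lt (hc i) (hidle i) hlen hne heval
  | finish => exact absurd trivial hret

lemma exists_feedbackFor (hP : P.WellCommunicated) (hmc : mc.SoundComplete p k ψ₁ ψ₂)
    (hinit : (p : ℝ) < 1 → ¬ ψ₂.Sat (MDP.parallel M) (MDP.parallel M).init) (c : Config M) :
    ∃ fb, c.FeedbackFor P mc k fb := by
  classical
  choose pos hpos using fun i => (c.learner i).exists_positiveFeedback k
  cases hr : mc c.components with
  | none => exact ⟨pos, .inl ⟨hr, hpos⟩⟩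
  | some r =>
    have hcex := (hmc c.components).2 r hr
    have hne : r ≠ [] := IsCounterexample.ne_nil (fun i => (c.learner i).K) hinit hcex
    obtain ⟨j, hj⟩ := P.exists_selects hP (as := r.map Prod.fst) (by simpa using hne) (by
      intro a ha
      have := hcex.isPath.mem_alphabet ha
      simpa [MDP.parallel, components, MDP.sup] using this)
    refine ⟨Function.update pos j (.negative (project (fun i => (c.learner i).K) j
      (MDP.parallel c.components).init r)), .inr ⟨r, hr, j, hj, by simp, fun i hi => ?_⟩⟩
    simpa [hi] using hpos i

lemma exists_step (hP : P.WellCommunicated) (hmc : mc.SoundComplete p k ψ₁ ψ₂)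
    (hinit : (p : ℝ) < 1 → ¬ ψ₂.Sat (MDP.parallel M) (MDP.parallel M).init)
    (hret : ¬ c.returned) : ∃ c', Step P mc k c c' := by
  by_cases hlearn : ∃ i, (c.learner i).learning
  · obtain ⟨i, hi⟩ := hlearn
    obtain ⟨l, hl⟩ := Learner.exists_step (k := k) hi
    exact ⟨_, .learn hret i l hl⟩
  · rw [not_exists] at hlearn
    obtain ⟨fb, hfb⟩ := exists_feedbackFor hP hmc hinit c
    by_cases hex : ∃ i, fb i ≠ .none
    · exact ⟨_, .refine hret hlearn fb hfb hex⟩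
    · simp only [not_exists, not_not] at hex
      obtain rfl : fb = fun _ => .none := funext hex
      exact ⟨_, .finish hret hlearn hfb⟩

lemma Step.not_returned (h : Step P mc k c c') : ¬ c.returned := by
  cases h <;> assumption

lemma Reachable.models (hmc : mc.SoundComplete p k ψ₁ ψ₂) (h : Reachable P mc k c)
    (hret : c.returned) : (MDP.parallel c.components).Models (.until p k ψ₁ ψ₂) := by
  cases h with
  | refl => exact hret.elim
  | tail _ h =>
    cases h with
    | learn => exact hret.elim
    | refine => exact hret.elim
    | finish _ _ hfb =>
      rcases hfb with ⟨hnone, -⟩ | ⟨r, -, j, -, hj, -⟩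
      · exact (hmc _).1.mp hnone
      -- With a counterexample path the selected subsystem would have negative feedback, contrary to
      -- the absence of feedback.
      · cases hj

lemma not_exists_infinite_run (hmc : mc.SoundComplete p k ψ₁ ψ₂) :
    ¬ ∃ run : ℕ → Config M, run 0 = initial M ∧ ∀ n, Step P mc k (run n) (run (n + 1)) := by
  rintro ⟨run, h0, hrun⟩
  have hreach : ∀ n, Reachable P mc k (run n) := by
    intro n
    induction n with
    | zero => rw [h0]; exact .refl
    | succ n ih => exact ih.tail (hrun n)
  have hret : ∀ n, ¬ (run n).returned := fun n => (hrun n).not_returned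
  -- Each configuration of an infinite run has a successor and so has not returned; the ranks would
  -- descend forever in a well-order.
  exact (RelEmbedding.natGT (fun n => (run n).rank k) fun n =>
    (hrun n).rank_lt hmc ((hreach n).inv hmc) (hret _)).not_wellFounded wellFounded_lt

end

end Config

end Algorithm

end SupSyn

theorem theorem2 {Act AP : Type} {N : ℕ} (M : Fin N → SupSyn.MDP Act AP)
    (P : SupSyn.ActionPartition M) (hP : P.WellCommunicated)
    (p : unitInterval) (k : ℕ) (ψ₁ ψ₂ : SupSyn.LiveFormula AP)
    (hinit : (p : ℝ) < 1 →
      ¬ ψ₂.Sat (SupSyn.MDP.parallel M) (SupSyn.MDP.parallel M).init)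
    (mc : SupSyn.ModelChecker Act AP N) (hmc : mc.SoundComplete p k ψ₁ ψ₂) :
    (¬ ∃ run : ℕ → SupSyn.Config M, run 0 = SupSyn.Config.initial M ∧
      ∀ n, SupSyn.Config.Step P mc k (run n) (run (n + 1))) ∧
    (∀ c : SupSyn.Config M, SupSyn.Config.Reachable P mc k c → ¬ c.returned →
      ∃ c', SupSyn.Config.Step P mc k c c') ∧
    (∀ c : SupSyn.Config M, SupSyn.Config.Reachable P mc k c → c.returned →
      (SupSyn.MDP.parallel fun i => (M i).sup (c.learner i).K).Models
        (.until p k ψ₁ ψ₂)) := by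
  refine ⟨SupSyn.Config.not_exists_infinite_run hmc, ?_, ?_⟩
  · exact fun c _ hret => SupSyn.Config.exists_step hP hmc hinit hret
  · exact fun c hc hret => hc.models hmc hret
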